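/- Let $(W,S)$ be a finite Coxeter system of rank $n_0$, with simple reflections $s_i$ indexed by $i\in[n_0]$, and let $\ell$ be its Coxeter length. For $I\subseteq[n_0]$ let $W_I$ be the parabolic subgroup generated by $\{s_i\mid i\in I\}$ and let $w_0(W_I)$ be its longest element. For an integer $0\le x\le n_0$ put $$\mathsf{maxw}_0(W,x):=\max\{\ell(w_0(W_I)) \mid I\subseteq[n_0],\ |I|=x\}.$$ Then, for every integer $x$ with $0\le x\le n_0$: (i) if $W$ is of type $A_n$, then $\mathsf{maxw}_0(W,x)=\binom{x+1}{2}$; (ii) if $W$ is of type $B_n$ or $C_n$, then $\mathsf{maxw}_0(W,x)=x^2$; (iii) if $W$ is of type $D_n$ with $n\ge 3$ (where $D_3=A_3$), then $\mathsf{maxw}_0(W,x)=x^2-x$ when $x>3$, and $\mathsf{maxw}_0(W,x)=\binom{x+1}{2}$ when $x\le 3$; (iv) if $W$ is of type $E_6$, $E_7$ or $E_8$, then $\mathsf{maxw}_0(W,x)=0,1,3,6,12,20,36,63,120$ for $x=0,1,2,3,4,5,6,7,8$ respectively (as far as $x\le n_0$); (v) if $W$ is of type $F_4$, then $\mathsf{maxw}_0(W,x)=0,1,4,9,24$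 for $x=0,1,2,3,4$ respectively; (vi) if $W$ is of type $H_3$ or $H_4$, then $\mathsf{maxw}_0(W,x)=0,1,5,15,60$ for $x=0,1,2,3,4$ respectively (as far as $x\le n_0$); (vii) if $W$ is of type $I_2(n)$ with $n\ge 2$ (the dihedral group of order $2n$), then $\mathsf{maxw}_0(W,x)=n$ when $x=2$, and $\mathsf{maxw}_0(W,x)=x$ when $x<2$. -/

import Mathlib

/-- The Coxeter matrix of type `Cₙ`. The Weyl groups of the root systems `Bₙ` and `Cₙ` have the
same Coxeter diagram, so this is the Coxeter matrix of type `Bₙ`. -/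
def coxeterC (n : ℕ) : CoxeterMatrix (Fin n) := CoxeterMatrix.B n

/-- The edges of the Coxeter diagram of type `Dₙ` on the nodes `0, …, n - 1`, each written with
its smaller end first: the path `0 — 1 — ⋯ — (n - 2)` and the edge `(n - 3) — (n - 1)`.
```
                       o n-2
                      /
    o --- o ⬝ ⬝ ⬝ ⬝ o n-3
    0     1           \
                       o n-1
```
-/
def edgeD (n i j : ℕ) : Prop := (i + 1 = j ∧ j + 1 < n) ∨ (i + 2 = j ∧ j + 1 = n)

instance (n i j : ℕ) : Decidable (edgeD n i j) := by unfold edgeD; infer_instance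

/-- The Coxeter matrix of type `Dₙ`. (The matrix `CoxeterMatrix.D n` is not used: there the nodes
`n - 3`, `n - 2`, `n - 1` form a triangle, so it is not the diagram of type `Dₙ`.) -/
def coxeterD (n : ℕ) : CoxeterMatrix (Fin n) where
  M := Matrix.of fun i j : Fin n ↦
    if i = j then 1 else if edgeD n i j ∨ edgeD n j i then 3 else 2
  isSymm := by
    ext i j
    simp only [Matrix.transpose_apply, Matrix.of_apply, eq_comm (a := j) (b := i),
      or_comm (a := edgeD n j i)]
  diagonal := by simp
  off_diagonal i j h := by
    simp only [Matrix.of_apply, if_neg h]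
    split_ifs <;> decide

/-- `M` is the Coxeter matrix `X` up to relabelling the nodes, that is, the Coxeter diagrams of
`M` and `X` are isomorphic as labelled graphs. -/
def CoxeterMatrix.IsOfType {B B' : Type*} (M : CoxeterMatrix B) (X : CoxeterMatrix B') : Prop :=
  ∃ e : B ≃ B', M.reindex e = X

namespace CoxeterSystem

variable {B W : Type*} [Group W] {M : CoxeterMatrix B} (cs : CoxeterSystem M W)

/-- The parabolic subgroup `W_I` generated by the simple reflections `s i`, `i ∈ I`. -/
def parabolic (I : Set B) : Subgroup W := Subgroup.closure (cs.simple '' I)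

/-- `w` is a longest element of the parabolic subgroup `W_I`. -/
def IsLongest (I : Set B) (w : W) : Prop :=
  w ∈ cs.parabolic I ∧ ∀ v ∈ cs.parabolic I, cs.length v ≤ cs.length w

/-- The set of all lengths `ℓ(w₀(W_I))`, where `I` runs over the sets of nodes of size `x`. -/
def longestLengths (x : ℕ) : Set ℕ :=
  {m | ∃ (I : Finset B) (w : W), I.card = x ∧ cs.IsLongest (I : Set B) w ∧ cs.length w = m}

/-- `maxw₀(W, x) = max {ℓ(w₀(W_I)) | |I| = x}`. -/
noncomputable def maxw0 (x : ℕ) : ℕ := sSup (cs.longestLengths x)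

/-- A longest element of `W_I` exists when `W` is finite. -/
theorem exists_isLongest [Finite W] (I : Set B) : ∃ w, cs.IsLongest I w := by
  obtain ⟨w, hw, h⟩ := Set.exists_max_image (cs.parabolic I : Set W) cs.length
    (Set.toFinite _) ⟨1, one_mem _⟩
  exact ⟨w, hw, h⟩

/-- For finite `W` and `x` at most the rank, the supremum in `maxw0` is an attained maximum. -/
theorem isGreatest_maxw0 [Finite W] [Fintype B] {x : ℕ} (hx : x ≤ Fintype.card B) :
    IsGreatest (cs.longestLengths x) (cs.maxw0 x) := by
  have hfin : (cs.longestLengths x).Finite :=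
    (Set.finite_range cs.length).subset (by rintro m ⟨I, w, -, -, rfl⟩; exact ⟨w, rfl⟩)
  have hne : (cs.longestLengths x).Nonempty := by
    obtain ⟨I, -, hI⟩ := Finset.exists_subset_card_eq (s := (Finset.univ : Finset B)) (n := x)
      (by simpa using hx)
    obtain ⟨w, hw⟩ := cs.exists_isLongest (I : Set B)
    exact ⟨_, I, w, hI, hw, rfl⟩
  exact ⟨Nat.sSup_mem hne hfin.bddAbove, fun m hm => le_csSup hfin.bddAbove hm⟩

end CoxeterSystem

/-- The values for types `E₆`, `E₇`, `E₈`; the value at `x ≥ 9` is never used. -/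
def tableE : ℕ → ℕ
  | 0 => 0
  | 1 => 1
  | 2 => 3
  | 3 => 6
  | 4 => 12
  | 5 => 20
  | 6 => 36
  | 7 => 63
  | 8 => 120
  | _ => 0

/-- The values for type `F₄`; the value at `x ≥ 5` is never used. -/
def tableF : ℕ → ℕ
  | 0 => 0
  | 1 => 1
  | 2 => 4
  | 3 => 9
  | 4 => 24
  | _ => 0

/-- The values for types `H₃`, `H₄`; the value at `x ≥ 5` is never used. -/
def tableH : ℕ → ℕ
  | 0 => 0
  | 1 => 1
  | 2 => 5
  | 3 => 15
  | 4 => 60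
  | _ => 0

/-! Let `W` act on the span of simple roots α_i through the reflections α_j ↦ α_j - A_ij α_i of a
generalized Cartan matrix `A`. The length of `w` is the number of positive roots that `w` makes
negative (`length_eq_card_inversions`), and a longest element of W_I makes negative exactly those
supported in `I` (`IsLongest.length_eq_card`). Hence `maxw0` is the largest number of positive roots
supported in `x` nodes (`maxw0_eq_of_isPositiveRoots`). The maximum is attained on subdiagrams A_x
and B_x in types A and B, on A_x or D_x in type D, and in type E on A_1, A_2, A_3, D_4, D_5, E_6,
E_7, E_8.

Length and roots are linked by `geomRep_single_mem`: if `i` is not a right descent of `w`, then w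
α_i has nonnegative coordinates. Splitting off from `w` an alternating word in two generators
reduces this to an explicit rank-two computation. "Nonnegative" means lying in a subsemiring `C` of
a commutative ring with C ∩ -C = 0. So no inner product is needed: `A` may be an asymmetric integer
matrix, and types H_3, H_4 live over ℤ[φ]. Nor need a set of roots be shown to be an orbit: it
suffices that it contains the simple roots and that each simple reflection permutes the others
(`IsPositiveRoots`).

In the classical types the roots supported in `I` are counted by injections into pairs of nodes. In
the exceptional types the roots are coded as numbers and the count is a finite check. The dihedral
groups, with arbitrarily large label, are treated by alternating words alone. -/

/-! ### Splitting off alternating words -/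

namespace CoxeterSystem

variable {B W : Type*} [Group W] {M : CoxeterMatrix B} (cs : CoxeterSystem M W)

/-- Stripping an alternating word in `i`, `j` from the right end of `w`. -/
theorem exists_eq_mul_alternatingWord (w : W) (i j : B) (hi : ¬cs.IsRightDescent w i) :
    ∃ (v : W) (k : ℕ), w = v * cs.wordProd (alternatingWord i j k) ∧
      cs.length w = cs.length v + k ∧ ¬cs.IsRightDescent v i ∧ ¬cs.IsRightDescent v j ∧
      (cs.IsRightDescent w j → 0 < k) := by
  induction h : cs.length w using Nat.strong_induction_on generalizing w i j with
  | _ n ih =>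
    subst h
    by_cases hj : cs.IsRightDescent w j
    · have hl := cs.isRightDescent_iff.1 hj
      have hj' : ¬cs.IsRightDescent (w * cs.simple j) j :=
        cs.isRightDescent_iff_not_isRightDescent_mul.1 hj
      -- After removing s_j the element has no right descent `j`, so the induction hypothesis
      -- applies with `i` and `j` exchanged.
      obtain ⟨v, k, hw, hk, h1, h2, -⟩ := ih _ (by omega) (w * cs.simple j) j i hj' rfl
      refine ⟨v, k + 1, ?_, by omega, h2, h1, fun _ => k.succ_pos⟩
      rw [alternatingWord_succ, wordProd_concat, ← mul_assoc, ← hw,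
        simple_mul_simple_cancel_right]
    · exact ⟨w, 0, by simp [alternatingWord], by simp, hi, hj, fun h => absurd h hj⟩

/-- If `v * u` has no right descent `i`, where `u` is an alternating word ending in `j` whose length
adds to that of `v`, then `u` is shorter than the braid word of `i` and `j`. -/
theorem lt_of_not_isRightDescent_mul_alternatingWord {v : W} {i j : B} {k : ℕ} (hM : M i j ≠ 0)
    (hl : cs.length (v * cs.wordProd (alternatingWord i j k)) = cs.length v + k)
    (hi : ¬cs.IsRightDescent (v * cs.wordProd (alternatingWord i j k)) i) : k < M i j := by
  -- Otherwise appending s_i would give a reduced alternating word of length `k + 1 > M i j`, which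
  -- is impossible.
  by_contra! hk
  have h1 := cs.not_isRightDescent_iff.1 hi
  rw [hl, mul_assoc, ← wordProd_concat, ← alternatingWord_succ] at h1
  have h2 := cs.length_mul_le v (cs.wordProd (alternatingWord j i (k + 1)))
  have h3 := cs.not_isReduced_alternatingWord j i (m := k + 1) (by rwa [M.symmetric])
    (by rw [M.symmetric]; omega)
  have h4 := cs.length_wordProd_le (alternatingWord j i (k + 1))
  rw [IsReduced, length_alternatingWord] at h3
  rw [length_alternatingWord] at h4
  omega

end CoxeterSystem

/-! ### Generalized Cartan matrices and their reflections -/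

namespace CoxeterMatrix

variable {B K : Type*} [CommRing K]

/-- The entries `a = A i j` and `b = A j i` of a generalized Cartan matrix that are allowed for a
pair of nodes whose Coxeter matrix entry is `m`; `C` plays the role of the nonnegative scalars. -/
def IsCartanPair (C : Subsemiring K) (m : ℕ) (a b : K) : Prop :=
  (m = 2 ∧ a = 0 ∧ b = 0) ∨ (m = 3 ∧ a = -1 ∧ b = -1) ∨
    (m = 4 ∧ (a = -1 ∧ b = -2 ∨ a = -2 ∧ b = -1)) ∨
    (m = 5 ∧ ∃ φ ∈ C, φ ^ 2 = φ + 1 ∧ a = -φ ∧ b = -φ)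

/-- `A` is a generalized Cartan matrix for the Coxeter matrix `M`. -/
structure IsCartan (M : CoxeterMatrix B) (C : Subsemiring K) (A : Matrix B B K) : Prop where
  diag : ∀ i, A i i = 2
  pair : ∀ i j, i ≠ j → IsCartanPair C (M i j) (A i j) (A j i)

theorem IsCartan.ne_zero {M : CoxeterMatrix B} {C : Subsemiring K} {A : Matrix B B K}
    (hA : M.IsCartan C A) {i j : B} (hij : i ≠ j) : M i j ≠ 0 := by
  rcases hA.pair i j hij with ⟨h, -⟩ | ⟨h, -⟩ | ⟨h, -⟩ | ⟨h, -⟩ <;> omega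

section Reflection

variable [Fintype B] [DecidableEq B] (A : Matrix B B K)

/-- The reflection `v ↦ v - ⟨A i, v⟩ eᵢ`. -/
def cartanReflection (i : B) : Module.End K (B → K) :=
  LinearMap.id - (LinearMap.proj i ∘ₗ A.mulVecLin).smulRight (Pi.single i 1)

theorem cartanReflection_apply (i : B) (v : B → K) :
    cartanReflection A i v = v - (A.mulVec v i) • Pi.single i 1 := by
  simp [cartanReflection]

theorem cartanReflection_apply_of_ne {i k : B} (h : k ≠ i) (v : B → K) :
    cartanReflection A i v k = v k := by
  simp [cartanReflection_apply, h]

theorem cartanReflection_single (i j : B) :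
    cartanReflection A i (Pi.single j 1) = Pi.single j 1 - A i j • Pi.single i 1 := by
  simp [cartanReflection_apply]

variable {A} {M : CoxeterMatrix B} {C : Subsemiring K}

theorem IsCartan.reflection_left (hA : M.IsCartan C A) (i j : B) (v : B → K) (c d : K) :
    cartanReflection A i (v + c • Pi.single i 1 + d • Pi.single j 1) =
      v + (-A.mulVec v i - c - A i j * d) • Pi.single i 1 + d • Pi.single j 1 := by
  rw [map_add, map_add, map_smul, map_smul, cartanReflection_single, cartanReflection_single,
    cartanReflection_apply, hA.diag]
  module

theorem IsCartan.reflection_right (hA : M.IsCartan C A) (i j : B) (v : B → K) (c d : K) :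
    cartanReflection A j (v + c • Pi.single i 1 + d • Pi.single j 1) =
      v + c • Pi.single i 1 + (-A.mulVec v j - d - A j i * c) • Pi.single j 1 := by
  rw [add_right_comm, hA.reflection_left, add_right_comm]

/-- Both reflections preserve the coset v + K α_i + K α_j and act on its two coefficients by affine
maps that involve `v` only through `A.mulVec v i` and `A.mulVec v j`. The braid relation is thus
checked by iterating these maps, and no invariant complement to the plane is needed. -/
theorem IsCartan.isLiftable (hA : M.IsCartan C A) : M.IsLiftable (cartanReflection A) := by
  intro i j
  refine LinearMap.ext fun v => ?_
  have h0 : v = v + (0 : K) • Pi.single i 1 + (0 : K) • Pi.single j 1 := by simp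
  suffices h : ∃ c d : K, c = 0 ∧ d = 0 ∧
      ((cartanReflection A i * cartanReflection A j) ^ M i j) v =
        v + c • Pi.single i 1 + d • Pi.single j 1 by
    obtain ⟨c, d, rfl, rfl, h⟩ := h
    rw [h, ← h0]; rfl
  by_cases hij : i = j
  · subst hij
    refine ⟨0, 0, rfl, rfl, ?_⟩
    rw [M.diagonal, pow_one, Module.End.mul_apply]
    conv_lhs => rw [h0]
    rw [hA.reflection_left, hA.reflection_left, hA.diag]
    module
  have key : ∀ m, ((cartanReflection A i * cartanReflection A j) ^ m) v =
      ((cartanReflection A i * cartanReflection A j) ^ m)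
        (v + (0 : K) • Pi.single i 1 + (0 : K) • Pi.single j 1) := fun m => by rw [← h0]
  rcases hA.pair i j hij with ⟨hm, ha, hb⟩ | ⟨hm, ha, hb⟩ | ⟨hm, ⟨ha, hb⟩ | ⟨ha, hb⟩⟩ |
    ⟨hm, φ, -, hφ, ha, hb⟩ <;> rw [hm, key]
  all_goals
    simp only [pow_succ, pow_zero, one_mul, Module.End.mul_apply, hA.reflection_left,
      hA.reflection_right, ha, hb]
    generalize A.mulVec v i = p
    generalize A.mulVec v j = q
    refine ⟨_, _, ?_, ?_, rfl⟩
  any_goals ring1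
  -- For label 5 the coefficients vanish only modulo φ ^ 2 - φ - 1; the multiplier is the polynomial
  -- quotient.
  · linear_combination (p * (1 - φ - 4 * φ ^ 2 + 3 * φ ^ 3 + 4 * φ ^ 4 - φ ^ 5 - φ ^ 6) +
      q * (3 * φ - 3 * φ ^ 2 - 7 * φ ^ 3 + 4 * φ ^ 4 + 5 * φ ^ 5 - φ ^ 6 - φ ^ 7)) * hφ
  · linear_combination (p * (-2 * φ + 2 * φ ^ 2 + 3 * φ ^ 3 - φ ^ 4 - φ ^ 5) +
      q * (1 - φ - 4 * φ ^ 2 + 3 * φ ^ 3 + 4 * φ ^ 4 - φ ^ 5 - φ ^ 6)) * hφ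

end Reflection

end CoxeterMatrix

/-! ### The geometric representation -/

namespace CoxeterSystem

variable {B W K : Type*} [Group W] [CommRing K] [Fintype B] [DecidableEq B] {M : CoxeterMatrix B}
  {C : Subsemiring K} {A : Matrix B B K} (cs : CoxeterSystem M W) (hA : M.IsCartan C A)

/-- The geometric representation attached to a generalized Cartan matrix. -/
def geomRep : W →* Module.End K (B → K) := cs.lift ⟨_, hA.isLiftable⟩

theorem geomRep_simple (i : B) :
    cs.geomRep hA (cs.simple i) = CoxeterMatrix.cartanReflection A i :=
  cs.lift_apply_simple hA.isLiftable i

theorem geomRep_mul_apply (u w : W) (v : B → K) :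
    cs.geomRep hA (u * w) v = cs.geomRep hA u (cs.geomRep hA w v) := by
  rw [map_mul, Module.End.mul_apply]

theorem geomRep_simple_single (i : B) :
    cs.geomRep hA (cs.simple i) (Pi.single i 1) = -Pi.single i 1 := by
  rw [geomRep_simple, CoxeterMatrix.cartanReflection_single, hA.diag]
  module

theorem geomRep_mul_simple_single (w : W) (i : B) :
    cs.geomRep hA (w * cs.simple i) (Pi.single i 1) = -cs.geomRep hA w (Pi.single i 1) := by
  rw [geomRep_mul_apply, geomRep_simple_single, map_neg]

/-- The images of α_i under alternating words shorter than the braid word are positive roots of the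
rank-two system, found by direct computation for each of the labels 2, 3, 4, 5. -/
theorem exists_geomRep_alternatingWord {i j : B} (hij : i ≠ j) {k : ℕ} (hk : k < M i j) :
    ∃ a ∈ C, ∃ b ∈ C, cs.geomRep hA (cs.wordProd (alternatingWord i j k)) (Pi.single i 1) =
      a • Pi.single i 1 + b • Pi.single j 1 := by
  have hi : ∀ c d : K, CoxeterMatrix.cartanReflection A i
      (c • Pi.single i 1 + d • Pi.single j 1) =
      (-c - A i j * d) • Pi.single i 1 + d • Pi.single j 1 := fun c d => by
    simpa using hA.reflection_left i j 0 c d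
  have hj : ∀ c d : K, CoxeterMatrix.cartanReflection A j
      (c • Pi.single i 1 + d • Pi.single j 1) =
      c • Pi.single i 1 + (-d - A j i * c) • Pi.single j 1 := fun c d => by
    simpa using hA.reflection_right i j 0 c d
  have h0 : (Pi.single i 1 : B → K) = (1 : K) • Pi.single i 1 + (0 : K) • Pi.single j 1 := by simp
  have h2 : (2 : K) ∈ C := ofNat_mem C 2
  have mem : ∀ {c d : K}, c ∈ C → c = d → d ∈ C := fun h e => e ▸ h
  rcases hA.pair i j hij with ⟨hm, ha, hb⟩ | ⟨hm, ha, hb⟩ | ⟨hm, ⟨ha, hb⟩ | ⟨ha, hb⟩⟩ |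
    ⟨hm, φ, hφC, hφ, ha, hb⟩ <;> rw [hm] at hk <;> interval_cases k
  all_goals
    conv in cs.geomRep hA _ _ => rw [h0]
    try simp only [alternatingWord_succ', Nat.not_even_one, Even.zero, even_two, if_true, if_false,
      show ¬Even 3 by decide, wordProd_cons, geomRep_mul_apply, geomRep_simple]
    simp only [alternatingWord, wordProd_nil, map_one, Module.End.one_apply, hi, hj, ha, hb]
    refine ⟨_, ?_, _, ?_, rfl⟩
  -- The only coefficients that occur are 0, 1, 2 and φ; the alternatives with `hφ` reduce powers of
  -- φ.
  any_goals first
    | exact mem C.zero_mem (by ring1)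
    | exact mem C.one_mem (by ring1)
    | exact mem h2 (by ring1)
    | exact mem hφC (by ring1)
    | exact mem hφC (by linear_combination (-1 : K) * hφ)
    | exact mem hφC (by linear_combination (-φ - 1) * hφ)
    | exact mem hφC (by linear_combination (φ + 1) * hφ)
    | exact mem C.zero_mem (by linear_combination (-φ ^ 2 - φ + 1) * hφ)
    | exact mem C.one_mem (by linear_combination (-φ - 1) * hφ)

/-- Write w = v u with `u` alternating in `i` and a right descent `j`. Then u α_i is a nonnegative
combination of α_i and α_j, and `v`, being shorter and without right descents `i`, `j`, sends both
to nonnegative vectors by induction. -/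
theorem geomRep_single_mem (w : W) (i : B)
    (hi : ¬cs.IsRightDescent w i) (k : B) : cs.geomRep hA w (Pi.single i 1) k ∈ C := by
  induction h : cs.length w using Nat.strong_induction_on generalizing w i with
  | _ n ih =>
    subst h
    by_cases hw : w = 1
    · subst hw
      rw [map_one, Module.End.one_apply, Pi.single_apply]
      split_ifs
      exacts [C.one_mem, C.zero_mem]
    obtain ⟨j, hj⟩ := cs.exists_rightDescent_of_ne_one hw
    have hij : i ≠ j := fun h => hi (h ▸ hj)
    obtain ⟨v, m, rfl, hl, h1, h2, h3⟩ := cs.exists_eq_mul_alternatingWord w i j hi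
    have hm := cs.lt_of_not_isRightDescent_mul_alternatingWord (hA.ne_zero hij) hl hi
    obtain ⟨a, ha, b, hb, hab⟩ := cs.exists_geomRep_alternatingWord hA hij hm
    have := h3 hj
    rw [geomRep_mul_apply, hab, map_add, map_smul, map_smul]
    exact C.add_mem (C.mul_mem ha (ih _ (by omega) v i h1 rfl))
      (C.mul_mem hb (ih _ (by omega) v j h2 rfl))

end CoxeterSystem

/-- `root` enumerates, without repetition, a set of positive roots for the reflections of `A`:
nonzero vectors with coordinates in `C`, among them the simple roots, such that the reflection in
the simple root `i` permutes those different from it. -/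
structure IsPositiveRoots {B K ι : Type*} [CommRing K] [Fintype B] [DecidableEq B]
    (C : Subsemiring K) (A : Matrix B B K) (root : ι → B → K) : Prop where
  pointed : ∀ x ∈ C, -x ∈ C → x = 0
  injective : Function.Injective root
  mem : ∀ p k, root p k ∈ C
  ne_zero : ∀ p, root p ≠ 0
  exists_simple : ∀ i, ∃ p, root p = Pi.single i 1
  exists_reflection : ∀ i p, root p ≠ Pi.single i 1 →
    ∃ q, root q = CoxeterMatrix.cartanReflection A i (root p)

/-! ### Length as a number of inversions -/

namespace CoxeterSystem

variable {B W K ι : Type*} [Group W] [CommRing K] [Fintype B] [DecidableEq B] [Fintype ι]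
  {M : CoxeterMatrix B} {C : Subsemiring K} {A : Matrix B B K} {root : ι → B → K}
  (cs : CoxeterSystem M W) (hA : M.IsCartan C A) (hR : IsPositiveRoots C A root)

theorem root_ne_neg_root {K B ι : Type*} [CommRing K] [Fintype B] [DecidableEq B]
    {C : Subsemiring K} {A : Matrix B B K} {root : ι → B → K} (hR : IsPositiveRoots C A root)
    (p q : ι) : root p ≠ -root q := by
  intro h
  refine hR.ne_zero p (funext fun k => hR.pointed _ (hR.mem p k) ?_)
  rw [h, Pi.neg_apply, neg_neg]
  exact hR.mem q k

omit [Fintype ι] in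
include hR in
theorem geomRep_root (w : W) (p : ι) :
    ∃ q, cs.geomRep hA w (root p) = root q ∨ cs.geomRep hA w (root p) = -root q := by
  induction w using cs.simple_induction_left with
  | one => exact ⟨p, by simp⟩
  | mul_simple_left w i ih =>
    obtain ⟨q, hq⟩ := ih
    rw [geomRep_mul_apply]
    by_cases hqi : root q = Pi.single i 1
    · refine ⟨q, ?_⟩
      rcases hq with hq | hq <;> simp [hq, hqi, geomRep_simple_single]
    · obtain ⟨r, hr⟩ := hR.exists_reflection i q hqi
      refine ⟨r, ?_⟩
      rcases hq with hq | hq <;> simp [hq, hr, geomRep_simple]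

/-- The positive roots that `w` makes negative. -/
noncomputable def inversions (root : ι → B → K) (w : W) : Finset ι :=
  open Classical in {p | ∃ q, cs.geomRep hA w (root p) = -root q}

theorem mem_inversions {w : W} {p : ι} :
    p ∈ cs.inversions hA root w ↔ ∃ q, cs.geomRep hA w (root p) = -root q := by
  simp [inversions]

include hR in
-- The reflection s_i permutes the positive roots other than α_i, which matches the inversions of w
-- s_i other than α_i with those of `w`. The root α_i itself is an inversion of w s_i but not of
-- `w`.
theorem card_inversions_mul_simple (w : W) (i : B)
    (hi : ¬cs.IsRightDescent w i) :
    (cs.inversions hA root (w * cs.simple i)).card = (cs.inversions hA root w).card + 1 := by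
  classical
  obtain ⟨p, hp⟩ := hR.exists_simple i
  have hne : ∀ r, r ≠ p → root r ≠ Pi.single i 1 := fun r hr h =>
    hr (hR.injective (h.trans hp.symm))
  choose! τ hτ using fun r (hr : r ≠ p) => hR.exists_reflection i r (hne r hr)
  have hτ' : ∀ r, r ≠ p → root (τ r) = cs.geomRep hA (cs.simple i) (root r) := by
    simpa [geomRep_simple] using hτ
  have hinv : ∀ v, cs.geomRep hA (cs.simple i) (cs.geomRep hA (cs.simple i) v) = v := fun v => by
    rw [← geomRep_mul_apply, simple_mul_simple_self, map_one, Module.End.one_apply]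
  have hτp : ∀ r, r ≠ p → τ r ≠ p := fun r hr h => by
    have h1 := hτ' r hr
    rw [h, hp] at h1
    have h2 := congrArg (cs.geomRep hA (cs.simple i)) h1
    rw [hinv, geomRep_simple_single, ← hp] at h2
    exact root_ne_neg_root hR r p h2.symm
  have hττ : ∀ r, r ≠ p → τ (τ r) = r := fun r hr => hR.injective (by
    rw [hτ' _ (hτp r hr), hτ' r hr, hinv])
  -- Positivity of w α_i excludes the negative sign because `C` is pointed.
  have hpw : ∃ q, cs.geomRep hA w (root p) = root q := by
    obtain ⟨q, hq | hq⟩ := cs.geomRep_root hA hR w p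
    · exact ⟨q, hq⟩
    refine absurd (funext fun k => ?_) (hR.ne_zero q)
    refine hR.pointed _ (hR.mem q k) ?_
    rw [← Pi.neg_apply, ← hq, hp]
    exact cs.geomRep_single_mem hA w i hi k
  have hmem : p ∈ cs.inversions hA root (w * cs.simple i) := by
    obtain ⟨q, hq⟩ := hpw
    rw [mem_inversions, hp, geomRep_mul_simple_single, ← hp, hq]
    exact ⟨q, rfl⟩
  have hnmem : p ∉ cs.inversions hA root w := by
    obtain ⟨q, hq⟩ := hpw
    rw [mem_inversions, hq]
    rintro ⟨r, hr⟩
    exact root_ne_neg_root hR _ _ hr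
  have hmap : ∀ r, r ≠ p →
      (r ∈ cs.inversions hA root (w * cs.simple i) ↔ τ r ∈ cs.inversions hA root w) :=
    fun r hr => by rw [mem_inversions, mem_inversions, hτ' r hr, geomRep_mul_apply]
  rw [← Finset.card_erase_add_one hmem, add_left_inj]
  have hne' : ∀ r ∈ cs.inversions hA root w, r ≠ p := fun r hr h => hnmem (h ▸ hr)
  refine Finset.card_nbij' τ τ ?_ ?_ ?_ ?_
  · intro r hr
    rw [Finset.mem_coe, Finset.mem_erase] at hr
    exact (hmap r hr.1).1 hr.2
  · intro r hr
    rw [Finset.mem_coe, Finset.mem_erase]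
    refine ⟨hτp r (hne' r hr), (hmap _ (hτp r (hne' r hr))).2 ?_⟩
    rwa [hττ r (hne' r hr)]
  · intro r hr
    rw [Finset.mem_coe, Finset.mem_erase] at hr
    exact hττ r hr.1
  · exact fun r hr => hττ r (hne' r hr)

include hR in
theorem length_eq_card_inversions (w : W) :
    cs.length w = (cs.inversions hA root w).card := by
  induction h : cs.length w generalizing w with
  | zero =>
    rw [length_eq_zero_iff] at h
    subst h
    symm
    rw [Finset.card_eq_zero, Finset.eq_empty_iff_forall_notMem]
    intro p hp
    obtain ⟨q, hq⟩ := (cs.mem_inversions hA).1 hp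
    rw [map_one, Module.End.one_apply] at hq
    exact root_ne_neg_root hR _ _ hq
  | succ n ih =>
    have hw : w ≠ 1 := by rintro rfl; simp at h
    obtain ⟨i, hi⟩ := cs.exists_rightDescent_of_ne_one hw
    have h1 := cs.isRightDescent_iff.1 hi
    have h2 := cs.card_inversions_mul_simple hA hR (w * cs.simple i) i
      (cs.isRightDescent_iff_not_isRightDescent_mul.1 hi)
    rw [simple_mul_simple_cancel_right] at h2
    rw [h2, ← ih (w * cs.simple i) (by omega)]

/-- A generator s_i changes only the coordinate `i`. -/
theorem geomRep_apply_of_mem_parabolic {I : Set B} {w : W} (hw : w ∈ cs.parabolic I) {k : B}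
    (hk : k ∉ I) (v : B → K) : cs.geomRep hA w v k = v k := by
  induction hw using Subgroup.closure_induction generalizing v with
  | mem x hx =>
    obtain ⟨i, hi, rfl⟩ := hx
    rw [geomRep_simple, CoxeterMatrix.cartanReflection_apply_of_ne]
    rintro rfl
    exact hk hi
  | one => simp
  | mul x y _ _ hx hy => rw [geomRep_mul_apply, hx, hy]
  | inv x _ hx =>
    rw [← hx (cs.geomRep hA x⁻¹ v), ← geomRep_mul_apply, mul_inv_cancel, map_one,
      Module.End.one_apply]

include hA hR in
/-- The length of a longest element of `W_I` is the number of positive roots supported in `I`. -/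
theorem IsLongest.length_eq_card {I : Set B} {w : W}
    (hw : cs.IsLongest I w) {s : Finset ι} (hs : ∀ p, p ∈ s ↔ ∀ k, root p k ≠ 0 → k ∈ I) :
    cs.length w = s.card := by
  rw [cs.length_eq_card_inversions hA hR]
  congr 1
  ext p
  rw [mem_inversions, hs]
  constructor
  · rintro ⟨q, hq⟩ k hk
    -- A coordinate outside `I` is fixed by `w`, so it equals both a nonnegative and a negated
    -- nonnegative scalar, hence is 0.
    by_contra hkI
    have h := congrFun hq k
    rw [cs.geomRep_apply_of_mem_parabolic hA hw.1 hkI] at h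
    refine hk (hR.pointed _ (hR.mem p k) ?_)
    rw [h, Pi.neg_apply, neg_neg]
    exact hR.mem q k
  · intro hp
    obtain ⟨q, hq | hq⟩ := cs.geomRep_root hA hR w p
    swap
    · exact ⟨q, hq⟩
    refine absurd (funext fun k => ?_) (hR.ne_zero q)
    refine hR.pointed _ (hR.mem q k) ?_
    -- Expanded in simple roots α_i with `i ∈ I`, the root is sent to a nonpositive vector, since
    -- each such `i` is a right descent of the longest element.
    have hdec : root p = ∑ i, root p i • Pi.single i (1 : K) := by
      ext k
      simp [Finset.sum_apply, Pi.single_apply]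
    rw [← hq, hdec, map_sum, Finset.sum_apply, ← Finset.sum_neg_distrib]
    refine C.sum_mem fun i _ => ?_
    by_cases hi : root p i = 0
    · simp [hi]
    have hiI : i ∈ I := hp i hi
    have hle := hw.2 _ (mul_mem hw.1 (Subgroup.subset_closure ⟨i, hiI, rfl⟩))
    have hdesc : cs.IsRightDescent w i := by
      have := cs.length_mul_simple_ne w i
      unfold IsRightDescent
      omega
    have := cs.geomRep_single_mem hA _ i
      (cs.isRightDescent_iff_not_isRightDescent_mul.1 hdesc) k
    rw [geomRep_mul_simple_single] at this
    rw [map_smul, Pi.smul_apply, smul_eq_mul, ← mul_neg]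
    exact C.mul_mem (hR.mem p i) this

include hA hR in
/-- Computing `maxw0` by counting positive roots. -/
theorem maxw0_eq_of_isPositiveRoots [Finite W] {x N : ℕ}
    (hle : ∀ (I : Finset B) (s : Finset ι), I.card = x →
      (∀ p ∈ s, ∀ k, root p k ≠ 0 → k ∈ I) → s.card ≤ N)
    (hge : ∃ (I : Finset B) (s : Finset ι), I.card = x ∧
      (∀ p ∈ s, ∀ k, root p k ≠ 0 → k ∈ I) ∧ N ≤ s.card) : cs.maxw0 x = N := by
  classical
  have hlen : ∀ (I : Finset B) (w : W), cs.IsLongest (I : Set B) w →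
      cs.length w = ({p | ∀ k, root p k ≠ 0 → k ∈ I} : Finset ι).card := fun I w hw =>
    hw.length_eq_card cs hA hR (by simp)
  have hle' : ∀ m ∈ cs.longestLengths x, m ≤ N := by
    rintro m ⟨I, w, hI, hw, rfl⟩
    rw [hlen I w hw]
    exact hle I _ hI (by simp)
  obtain ⟨I, s, hI, hs, hN⟩ := hge
  obtain ⟨w, hw⟩ := cs.exists_isLongest (I : Set B)
  have hmem : cs.length w ∈ cs.longestLengths x := ⟨I, w, hI, hw, rfl⟩
  refine le_antisymm (csSup_le ⟨_, hmem⟩ hle') (le_csSup_of_le ⟨N, hle'⟩ hmem (hN.trans ?_))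
  rw [hlen I w hw]
  exact Finset.card_le_card fun p hp => by simpa using hs p hp

/-! ### Invariance under relabelling of the nodes -/

section Reindex

variable {B' : Type*} (e : B ≃ B')

omit [Fintype B] [DecidableEq B] in
theorem wordProd_reindex (ω : List B') :
    (cs.reindex e).wordProd ω = cs.wordProd (ω.map e.symm) := by
  rw [wordProd, wordProd, List.map_map]
  rfl

omit [Fintype B] [DecidableEq B] in
theorem length_reindex (w : W) : (cs.reindex e).length w = cs.length w := by
  apply le_antisymm
  · obtain ⟨ω, hω, rfl⟩ := cs.exists_isReduced w
    have := (cs.reindex e).length_wordProd_le (ω.map e)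
    rw [wordProd_reindex] at this
    simpa [hω.eq, Function.comp_def] using this
  · obtain ⟨ω, hω, rfl⟩ := (cs.reindex e).exists_isReduced w
    rw [hω.eq, wordProd_reindex]
    simpa using cs.length_wordProd_le (ω.map e.symm)

omit [Fintype B] [DecidableEq B] in
theorem parabolic_reindex (I : Set B') :
    (cs.reindex e).parabolic I = cs.parabolic (e.symm '' I) := by
  unfold parabolic
  rw [Set.image_image]
  rfl

omit [Fintype B] [DecidableEq B] in
theorem maxw0_reindex (x : ℕ) : (cs.reindex e).maxw0 x = cs.maxw0 x := by
  unfold maxw0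
  congr 1
  ext m
  simp only [longestLengths, Set.mem_ofPred_eq, IsLongest, length_reindex, parabolic_reindex]
  constructor
  · rintro ⟨I, w, h1, h2, h3⟩
    exact ⟨I.map e.symm.toEmbedding, w, by simpa using h1, by simpa using h2, h3⟩
  · rintro ⟨I, w, h1, h2, h3⟩
    exact ⟨I.map e.toEmbedding, w, by simpa using h1, by simpa [Set.image_image] using h2, h3⟩

end Reindex

end CoxeterSystem

/-! ### Cartan matrices of types A, B, D -/

section ClassicalTypes

/-- Rows of the classical Cartan matrices are sums of indicators of at most one column each; the
condition on `a` tells whether that neighbour exists. -/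
theorem sum_fin_ite_mul {n : ℕ} (g : ℕ → ℤ) (c : ℤ) (P : ℕ → Prop) [DecidablePred P] (a : ℕ)
    (h : ∀ j, P j → j = a) :
    ∑ j : Fin n, (if P j then c else 0) * g j = if a < n ∧ P a then c * g a else 0 := by
  split_ifs with ha
  · rw [Finset.sum_eq_single ⟨a, ha.1⟩]
    · simp [ha.2]
    · intro j _ hj
      rw [if_neg fun hP => hj (Fin.ext (h _ hP)), zero_mul]
    · simp
  · refine Finset.sum_eq_zero fun j _ => ?_
    rw [if_neg, zero_mul]
    intro hP
    have := h _ hP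
    exact ha ⟨this ▸ j.2, this ▸ hP⟩

/-- A generalized Cartan matrix of type `A`. -/
def cartanMatrixA (n : ℕ) : Matrix (Fin n) (Fin n) ℤ := Matrix.of fun i j =>
  (if (j : ℕ) = i then 2 else 0) + (if (i : ℕ) + 1 = j then -1 else 0) +
    (if (j : ℕ) + 1 = i then -1 else 0)

/-- A generalized Cartan matrix of type `B`. -/
def cartanMatrixB (n : ℕ) : Matrix (Fin n) (Fin n) ℤ := Matrix.of fun i j =>
  (if (j : ℕ) = i then 2 else 0) + (if (i : ℕ) + 1 = j then -1 else 0) +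
    (if (j : ℕ) + 1 = i ∧ (i : ℕ) + 1 < n then -1 else 0) +
    (if (j : ℕ) + 1 = i ∧ (i : ℕ) + 1 = n then -2 else 0)

/-- A generalized Cartan matrix of type `D`. -/
def cartanMatrixD (n : ℕ) : Matrix (Fin n) (Fin n) ℤ := Matrix.of fun i j =>
  (if (j : ℕ) = i then 2 else 0) + (if (i : ℕ) + 1 = j ∧ (j : ℕ) + 1 < n then -1 else 0) +
    (if (i : ℕ) + 2 = j ∧ (j : ℕ) + 1 = n then -1 else 0) +
    (if (j : ℕ) + 1 = i ∧ (i : ℕ) + 1 < n then -1 else 0) +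
    (if (j : ℕ) + 2 = i ∧ (i : ℕ) + 1 = n then -1 else 0)

theorem isCartan_A (n : ℕ) :
    (CoxeterMatrix.A n).IsCartan (Subsemiring.nonneg ℤ) (cartanMatrixA n) where
  diag i := by simp [cartanMatrixA]
  pair i j hij := by
    have : (i : ℕ) ≠ j := fun h => hij (Fin.ext h)
    simp only [CoxeterMatrix.A, cartanMatrixA, Matrix.of_apply, if_neg hij]
    by_cases h : (j : ℕ) + 1 = i ∨ (i : ℕ) + 1 = j
    · refine Or.inr (Or.inl ⟨if_pos h, ?_, ?_⟩) <;> split_ifs <;> omega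
    · refine Or.inl ⟨if_neg h, ?_, ?_⟩ <;> split_ifs <;> omega

theorem isCartan_B (n : ℕ) :
    (CoxeterMatrix.B n).IsCartan (Subsemiring.nonneg ℤ) (cartanMatrixB n) where
  diag i := by simp [cartanMatrixB]
  pair i j hij := by
    have : (i : ℕ) ≠ j := fun h => hij (Fin.ext h)
    have hi := i.2
    have hj := j.2
    simp only [CoxeterMatrix.B, cartanMatrixB, Matrix.of_apply, if_neg hij]
    -- For `n = 1` both truncated differences are 0, but then `i = j`, which is excluded.
    by_cases h1 : (i : ℕ) = n - 1 ∧ (j : ℕ) = n - 2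
    · refine Or.inr (Or.inr (Or.inl ⟨if_pos (Or.inl h1), Or.inr ⟨?_, ?_⟩⟩)) <;>
        split_ifs <;> omega
    by_cases h2 : (j : ℕ) = n - 1 ∧ (i : ℕ) = n - 2
    · refine Or.inr (Or.inr (Or.inl ⟨if_pos (Or.inr h2), Or.inl ⟨?_, ?_⟩⟩)) <;>
        split_ifs <;> omega
    rw [if_neg (not_or.2 ⟨h1, h2⟩)]
    by_cases h : (j : ℕ) + 1 = i ∨ (i : ℕ) + 1 = j
    · refine Or.inr (Or.inl ⟨if_pos h, ?_, ?_⟩) <;> split_ifs <;> omega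
    · refine Or.inl ⟨if_neg h, ?_, ?_⟩ <;> split_ifs <;> omega

theorem isCartan_D (n : ℕ) :
    (coxeterD n).IsCartan (Subsemiring.nonneg ℤ) (cartanMatrixD n) where
  diag i := by simp [cartanMatrixD]
  pair i j hij := by
    have : (i : ℕ) ≠ j := fun h => hij (Fin.ext h)
    simp only [coxeterD, cartanMatrixD, Matrix.of_apply, if_neg hij]
    by_cases h : edgeD n i j ∨ edgeD n j i
    · refine Or.inr (Or.inl ⟨if_pos h, ?_, ?_⟩) <;> unfold edgeD at h <;> split_ifs <;> omega
    · refine Or.inl ⟨if_neg h, ?_, ?_⟩ <;> unfold edgeD at h <;> split_ifs <;> omega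

theorem cartanReflection_A {n : ℕ} (g : ℕ → ℤ) (i k : Fin n) :
    CoxeterMatrix.cartanReflection (cartanMatrixA n) i (fun j => g j) k =
      g k - if (k : ℕ) = i then 2 * g i - (if (i : ℕ) + 1 < n then g (i + 1) else 0) -
        (if 0 < (i : ℕ) then g (i - 1) else 0) else 0 := by
  rw [CoxeterMatrix.cartanReflection_apply, Matrix.mulVec, dotProduct]
  simp only [cartanMatrixA, Matrix.of_apply, add_mul, Finset.sum_add_distrib]
  rw [sum_fin_ite_mul g 2 (· = (i : ℕ)) i (by simp),
    sum_fin_ite_mul g _ ((i : ℕ) + 1 = ·) (i + 1) (by omega),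
    sum_fin_ite_mul g _ (· + 1 = (i : ℕ)) (i - 1) (by omega)]
  simp only [Pi.sub_apply, Pi.smul_apply, Pi.single_apply, Fin.ext_iff, smul_eq_mul]
  have := i.2
  grind

theorem cartanReflection_B {n : ℕ} (g : ℕ → ℤ) (i k : Fin n) :
    CoxeterMatrix.cartanReflection (cartanMatrixB n) i (fun j => g j) k =
      g k - if (k : ℕ) = i then 2 * g i - (if (i : ℕ) + 1 < n then g (i + 1) else 0) -
        (if 0 < (i : ℕ) then (if (i : ℕ) + 1 = n then 2 * g (i - 1) else g (i - 1)) else 0)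
        else 0 := by
  rw [CoxeterMatrix.cartanReflection_apply, Matrix.mulVec, dotProduct]
  simp only [cartanMatrixB, Matrix.of_apply, add_mul, Finset.sum_add_distrib]
  rw [sum_fin_ite_mul g 2 (· = (i : ℕ)) i (by simp),
    sum_fin_ite_mul g _ ((i : ℕ) + 1 = ·) (i + 1) (by omega),
    sum_fin_ite_mul g _ (fun j => j + 1 = (i : ℕ) ∧ (i : ℕ) + 1 < n) (i - 1) (by omega),
    sum_fin_ite_mul g _ (fun j => j + 1 = (i : ℕ) ∧ (i : ℕ) + 1 = n) (i - 1) (by omega)]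
  simp only [Pi.sub_apply, Pi.smul_apply, Pi.single_apply, Fin.ext_iff, smul_eq_mul]
  have := i.2
  grind

theorem cartanReflection_D {n : ℕ} (g : ℕ → ℤ) (i k : Fin n) :
    CoxeterMatrix.cartanReflection (cartanMatrixD n) i (fun j => g j) k =
      g k - if (k : ℕ) = i then 2 * g i - (if (i : ℕ) + 2 < n then g (i + 1) else 0) -
        (if (i : ℕ) + 3 = n then g (i + 2) else 0) -
        (if 0 < (i : ℕ) ∧ (i : ℕ) + 1 < n then g (i - 1) else 0) -
        (if 1 < (i : ℕ) ∧ (i : ℕ) + 1 = n then g (i - 2) else 0)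
        else 0 := by
  rw [CoxeterMatrix.cartanReflection_apply, Matrix.mulVec, dotProduct]
  simp only [cartanMatrixD, Matrix.of_apply, add_mul, Finset.sum_add_distrib]
  rw [sum_fin_ite_mul g 2 (· = (i : ℕ)) i (by simp),
    sum_fin_ite_mul g _ (fun j => (i : ℕ) + 1 = j ∧ j + 1 < n) (i + 1) (by omega),
    sum_fin_ite_mul g _ (fun j => (i : ℕ) + 2 = j ∧ j + 1 = n) (i + 2) (by omega),
    sum_fin_ite_mul g _ (fun j => j + 1 = (i : ℕ) ∧ (i : ℕ) + 1 < n) (i - 1) (by omega),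
    sum_fin_ite_mul g _ (fun j => j + 2 = (i : ℕ) ∧ (i : ℕ) + 1 = n) (i - 2) (by omega)]
  simp only [Pi.sub_apply, Pi.smul_apply, Pi.single_apply, Fin.ext_iff, smul_eq_mul]
  have := i.2
  grind

end ClassicalTypes

/-! ### Positive roots of types A, B, D -/

section ClassicalRoots

/-- The coordinates, in the basis of simple roots of type `A`, of the root `e a - e b`. -/
def coordA (a b k : ℕ) : ℤ := if a ≤ k ∧ k < b then 1 else 0

/-- The coordinates, in the basis of simple roots of type `B`, of the root `e a + e b` if `s` is
true and `e a - e b` otherwise, where `e n = 0`. -/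
def coordB (a b : ℕ) (s : Bool) (k : ℕ) : ℤ :=
  if k < a then 0 else if k < b then 1 else if s then 2 else 0

/-- The coordinates, in the basis of simple roots of type `D`, of the root `e a + e b` if `s` is
true and `e a - e b` otherwise. -/
def coordD (n a b : ℕ) (s : Bool) (k : ℕ) : ℤ :=
  if s then if k + 1 = n then 1 else if k + 2 = n then if b + 2 ≤ n then 1 else 0 else
    if k < a then 0 else if k < b then 1 else 2
  else if a ≤ k ∧ k < b then 1 else 0

/-- The reflection exchanges e_i and e_{i+1}; the indices stay in order unless the root is α_i. -/
theorem exists_coordA (n a b i : ℕ) (hab : a < b) (hb : b ≤ n) (hi : i < n)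
    (h : ¬(a = i ∧ b = i + 1)) :
    ∃ a' b', a' < b' ∧ b' ≤ n ∧ ∀ k < n, coordA a' b' k = coordA a b k -
      if k = i then 2 * coordA a b i - (if i + 1 < n then coordA a b (i + 1) else 0) -
        (if 0 < i then coordA a b (i - 1) else 0) else 0 := by
  refine ⟨if a = i then i + 1 else if a = i + 1 then i else a,
    if b = i then i + 1 else if b = i + 1 then i else b, ?_, ?_, ?_⟩
  · grind
  · grind
  · intro k hk
    unfold coordA
    grind

/-- The last reflection negates e_{n-1}, toggling `s` when `b = n - 1`; the others exchange e_i and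
e_{i+1}, which fixes e_i + e_{i+1}. -/
theorem exists_coordB (n a b i : ℕ) (s : Bool) (hab : a < b)
    (hb : b < n ∨ s = true ∧ b = n) (hi : i < n)
    (h : ¬(a = i ∧ b = i + 1 ∧ (b = n ∨ s = false))) :
    ∃ a' b' s', a' < b' ∧ (b' < n ∨ s' = true ∧ b' = n) ∧ ∀ k < n,
      coordB a' b' s' k = coordB a b s k -
      if k = i then 2 * coordB a b s i - (if i + 1 < n then coordB a b s (i + 1) else 0) -
        (if 0 < i then (if i + 1 = n then 2 * coordB a b s (i - 1) else coordB a b s (i - 1))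
          else 0) else 0 := by
  by_cases h1 : i + 1 = n
  · refine ⟨a, b, if b = i then !s else s, hab, ?_, ?_⟩
    · grind
    · intro k hk
      unfold coordB
      grind
  by_cases h2 : a = i ∧ b = i + 1
  · refine ⟨a, b, s, hab, ?_, ?_⟩
    · grind
    · intro k hk
      unfold coordB
      grind
  refine ⟨if a = i then i + 1 else if a = i + 1 then i else a,
    if b = i then i + 1 else if b = i + 1 then i else b, s, ?_, ?_, ?_⟩
  · grind
  · grind
  · intro k hk
    unfold coordB
    grind

/-- The last reflection sends e_{n-2} to -e_{n-1} and e_{n-1} to -e_{n-2}: it fixes e_{n-2} -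
e_{n-1} and otherwise moves `b` between `n - 2` and `n - 1` while toggling `s`. -/
theorem exists_coordD (n a b i : ℕ) (s : Bool) (hn : 3 ≤ n) (hab : a < b) (hb : b < n)
    (hi : i < n) (h : ¬(a = i ∧ b = i + 1 ∧ s = false)) (h' : ¬(a + 2 = n ∧ i + 1 = n ∧ s = true)) :
    ∃ a' b' s', a' < b' ∧ b' < n ∧ ∀ k < n, coordD n a' b' s' k = coordD n a b s k -
      if k = i then 2 * coordD n a b s i - (if i + 2 < n then coordD n a b s (i + 1) else 0) -
        (if i + 3 = n then coordD n a b s (i + 2) else 0) -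
        (if 0 < i ∧ i + 1 < n then coordD n a b s (i - 1) else 0) -
        (if 1 < i ∧ i + 1 = n then coordD n a b s (i - 2) else 0) else 0 := by
  by_cases h1 : i + 1 = n
  · by_cases h2 : a + 2 = n
    · refine ⟨a, b, s, hab, hb, ?_⟩
      intro k hk
      unfold coordD
      grind
    by_cases h3 : b + 1 = n
    · refine ⟨a, b - 1, !s, by omega, by omega, ?_⟩
      intro k hk
      unfold coordD
      grind
    by_cases h4 : b + 2 = n
    · refine ⟨a, b + 1, !s, by omega, by omega, ?_⟩
      intro k hk
      unfold coordD
      grind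
    refine ⟨a, b, s, hab, hb, ?_⟩
    intro k hk
    unfold coordD
    grind
  by_cases h2 : a = i ∧ b = i + 1
  · refine ⟨a, b, s, hab, hb, ?_⟩
    intro k hk
    unfold coordD
    grind
  refine ⟨if a = i then i + 1 else if a = i + 1 then i else a,
    if b = i then i + 1 else if b = i + 1 then i else b, s, ?_, ?_, ?_⟩
  · grind
  · grind
  · intro k hk
    unfold coordD
    cases s <;> grind (splits := 20)

/-- The support is the interval from `a` to `b - 1`, so comparing coordinates at its ends suffices.
-/
theorem coordA_inj {n a b a' b' : ℕ} (hab : a < b) (hb : b ≤ n) (hab' : a' < b') (hb' : b' ≤ n)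
    (h : ∀ k < n, coordA a b k = coordA a' b' k) : a = a' ∧ b = b' := by
  have h1 := h a (by omega)
  have h2 := h a' (by omega)
  have h3 := h (b - 1) (by omega)
  have h4 := h (b' - 1) (by omega)
  unfold coordA at *
  grind

theorem coordB_inj {n a b a' b' : ℕ} {s s' : Bool} (hab : a < b) (hb : b < n ∨ s = true ∧ b = n)
    (hab' : a' < b') (hb' : b' < n ∨ s' = true ∧ b' = n)
    (h : ∀ k < n, coordB a b s k = coordB a' b' s' k) : a = a' ∧ b = b' ∧ s = s' := by
  have h1 := h a (by omega)
  have h2 := h a' (by omega)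
  have h3 := h (b - 1) (by omega)
  have h4 := h (b' - 1) (by omega)
  have h5 := h (n - 1) (by omega)
  have h6 := h b
  have h7 := h b'
  unfold coordB at *
  grind

theorem coordD_inj {n a b a' b' : ℕ} {s s' : Bool} (hn : 3 ≤ n) (hab : a < b) (hb : b < n)
    (hab' : a' < b') (hb' : b' < n)
    (h : ∀ k < n, coordD n a b s k = coordD n a' b' s' k) : a = a' ∧ b = b' ∧ s = s' := by
  have hs : s = s' := by
    have h5 := h (n - 1) (by omega)
    unfold coordD at *
    grind
  subst hs
  have h1 := h a (by omega)
  have h2 := h a' (by omega)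
  have h3 := h (b - 1) (by omega)
  have h4 := h (b' - 1) (by omega)
  have h6 := h b hb
  have h7 := h b' hb'
  have h8 := h (n - 2) (by omega)
  clear h
  unfold coordD at *
  cases s <;> grind (splits := 20)

/-- The positive roots of type `A`. -/
def rootA (n : ℕ) (p : {p : Fin (n + 1) × Fin (n + 1) // p.1 < p.2}) (k : Fin n) : ℤ :=
  coordA p.1.1 p.1.2 k

/-- The positive roots of type `B`. -/
def rootB (n : ℕ) (p : {p : Fin (n + 1) × Fin (n + 1) × Bool //
    p.1 < p.2.1 ∧ ((p.2.1 : ℕ) < n ∨ p.2.2 = true ∧ (p.2.1 : ℕ) = n)}) (k : Fin n) : ℤ :=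
  coordB p.1.1 p.1.2.1 p.1.2.2 k

/-- The positive roots of type `D`. -/
def rootD (n : ℕ) (p : {p : Fin n × Fin n × Bool // p.1 < p.2.1}) (k : Fin n) : ℤ :=
  coordD n p.1.1 p.1.2.1 p.1.2.2 k

theorem isPositiveRoots_A (n : ℕ) :
    IsPositiveRoots (Subsemiring.nonneg ℤ) (cartanMatrixA n) (rootA n) where
  pointed x hx hx' := by
    rw [Subsemiring.mem_nonneg] at hx hx'
    omega
  injective := by
    rintro ⟨⟨a, b⟩, hab⟩ ⟨⟨a', b'⟩, hab'⟩ h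
    obtain ⟨h1, h2⟩ := coordA_inj hab (Nat.lt_succ_iff.1 b.2) hab' (Nat.lt_succ_iff.1 b'.2)
      fun k hk => congrFun h ⟨k, hk⟩
    simpa [Fin.ext_iff] using ⟨h1, h2⟩
  mem p k := by
    rw [Subsemiring.mem_nonneg, rootA, coordA]
    split_ifs <;> simp
  ne_zero := by
    rintro ⟨⟨a, b⟩, hab : a < b⟩ h
    have := congrFun h ⟨a, by omega⟩
    simp [rootA, coordA, hab] at this
  exists_simple i := by
    refine ⟨⟨⟨i.castSucc, i.succ⟩, i.castSucc_lt_succ⟩, funext fun k => ?_⟩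
    simp only [rootA, coordA, Pi.single_apply, Fin.ext_iff, Fin.val_castSucc, Fin.val_succ]
    grind
  exists_reflection := by
    rintro i ⟨⟨a, b⟩, hab : a < b⟩ h
    obtain ⟨a', b', h1, h2, h3⟩ := exists_coordA n a b i hab (Nat.lt_succ_iff.1 b.2) i.2 (by
      rintro ⟨h1, h2⟩
      refine h (funext fun k => ?_)
      simp only [rootA, coordA, Pi.single_apply, Fin.ext_iff]
      grind)
    refine ⟨⟨⟨⟨a', by omega⟩, ⟨b', by omega⟩⟩, h1⟩, funext fun k => ?_⟩
    refine (h3 k k.2).trans ?_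
    exact (cartanReflection_A (coordA a b) i k).symm

theorem isPositiveRoots_B (n : ℕ) :
    IsPositiveRoots (Subsemiring.nonneg ℤ) (cartanMatrixB n) (rootB n) where
  pointed x hx hx' := by
    rw [Subsemiring.mem_nonneg] at hx hx'
    omega
  injective := by
    rintro ⟨⟨a, b, s⟩, hab⟩ ⟨⟨a', b', s'⟩, hab'⟩ h
    obtain ⟨h1, h2, h3⟩ := coordB_inj hab.1 hab.2 hab'.1 hab'.2 fun k hk => congrFun h ⟨k, hk⟩
    simpa [Fin.ext_iff] using ⟨h1, h2, h3⟩
  mem p k := by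
    rw [Subsemiring.mem_nonneg, rootB, coordB]
    split_ifs <;> simp
  ne_zero := by
    rintro ⟨⟨a, b, s⟩, (hab : a < b), hb⟩ h
    have := congrFun h ⟨a, by omega⟩
    simp [rootB, coordB, hab] at this
  exists_simple i := by
    -- The last simple root is the short root e_{n-1}, coded with `b = n` and sign true.
    refine ⟨⟨⟨i.castSucc, i.succ, decide ((i : ℕ) + 1 = n)⟩, i.castSucc_lt_succ, ?_⟩,
      funext fun k => ?_⟩
    · simp only [Fin.val_succ]
      grind
    · simp only [rootB, coordB, Pi.single_apply, Fin.ext_iff, Fin.val_castSucc, Fin.val_succ]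
      grind
  exists_reflection := by
    rintro i ⟨⟨a, b, s⟩, (hab : a < b), hb⟩ h
    obtain ⟨a', b', s', h1, h2, h3⟩ := exists_coordB n a b i s hab hb i.2 (by
      rintro ⟨h1, h2, h3⟩
      refine h (funext fun k => ?_)
      simp only [rootB, coordB, Pi.single_apply, Fin.ext_iff]
      grind)
    refine ⟨⟨⟨⟨a', by omega⟩, ⟨b', by omega⟩, s'⟩, h1, h2⟩, funext fun k => ?_⟩
    refine (h3 k k.2).trans ?_
    exact (cartanReflection_B (coordB a b s) i k).symm

theorem isPositiveRoots_D (n : ℕ) (hn : 3 ≤ n) :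
    IsPositiveRoots (Subsemiring.nonneg ℤ) (cartanMatrixD n) (rootD n) where
  pointed x hx hx' := by
    rw [Subsemiring.mem_nonneg] at hx hx'
    omega
  injective := by
    rintro ⟨⟨a, b, s⟩, hab⟩ ⟨⟨a', b', s'⟩, hab'⟩ h
    obtain ⟨h1, h2, h3⟩ := coordD_inj hn hab b.2 hab' b'.2 fun k hk => congrFun h ⟨k, hk⟩
    simpa [Fin.ext_iff] using ⟨h1, h2, h3⟩
  mem p k := by
    rw [Subsemiring.mem_nonneg, rootD, coordD]
    split_ifs <;> simp
  ne_zero := by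
    rintro ⟨⟨a, b, s⟩, hab : a < b⟩ h
    cases s
    · have := congrFun h a
      simp [rootD, coordD, hab] at this
    · have := congrFun h ⟨n - 1, by omega⟩
      simp [rootD, coordD, show n - 1 + 1 = n by omega] at this
  exists_simple i := by
    by_cases hi : (i : ℕ) + 1 = n
    -- The last simple root is e_{n-2} + e_{n-1}.
    · refine ⟨⟨⟨⟨n - 2, by omega⟩, i, true⟩, ?_⟩, funext fun k => ?_⟩
      · rw [Fin.lt_def]
        grind
      · simp only [rootD, coordD, Pi.single_apply, Fin.ext_iff]
        grind
    · refine ⟨⟨⟨i, ⟨i + 1, by omega⟩, false⟩, ?_⟩, funext fun k => ?_⟩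
      · simp [Fin.lt_def]
      · simp only [rootD, coordD, Pi.single_apply, Fin.ext_iff]
        grind
  exists_reflection := by
    rintro i ⟨⟨a, b, s⟩, hab : a < b⟩ h
    have hb := b.2
    have hab' : (a : ℕ) < b := hab
    obtain ⟨a', b', s', h1, h2, h3⟩ := exists_coordD n a b i s hn hab b.2 i.2 (by
      rintro ⟨h1, h2, h3⟩
      refine h (funext fun k => ?_)
      simp only [rootD, coordD, Pi.single_apply, Fin.ext_iff]
      grind) (by
      rintro ⟨h1, h2, h3⟩
      refine h (funext fun k => ?_)
      simp only [rootD, coordD, Pi.single_apply, Fin.ext_iff]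
      grind)
    refine ⟨⟨⟨⟨a', by omega⟩, ⟨b', by omega⟩, s'⟩, h1⟩, funext fun k => ?_⟩
    refine (h3 k k.2).trans ?_
    exact (cartanReflection_D (coordD n a b s) i k).symm

end ClassicalRoots

/-! ### Counting roots in types A, B, D -/

namespace CoxeterSystem

variable {W : Type*} [Group W] [Finite W]

theorem maxw0_A {n : ℕ} (cs : CoxeterSystem (CoxeterMatrix.A n) W) {x : ℕ} (hx : x ≤ n) :
    cs.maxw0 x = (x + 1).choose 2 := by
  classical
  refine cs.maxw0_eq_of_isPositiveRoots (isCartan_A n) (isPositiveRoots_A n) ?_ ?_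
  · intro I s hI hs
    have hJ : (I.map Fin.valEmbedding).card = x := by rw [Finset.card_map, hI]
    rw [← hJ, ← Finset.card_sym2]
    have key : ∀ p ∈ s, ∀ k, (p.1.1 : ℕ) ≤ k → k < p.1.2 → k ∈ I.map Fin.valEmbedding := by
      intro p hp k h1 h2
      have h3 := p.1.2.2
      exact Finset.mem_map.2 ⟨⟨k, by omega⟩, hs p hp _ (by simp [rootA, coordA, h1, h2]), rfl⟩
    -- A root is determined by the two ends of its support, an unordered pair of nodes of `I`,
    -- possibly equal.
    refine Finset.card_le_card_of_injOn (fun p => s((p.1.1 : ℕ), (p.1.2 : ℕ) - 1)) ?_ ?_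
    · rintro p hp
      have h : (p.1.1 : ℕ) < p.1.2 := p.2
      exact Finset.mk_mem_sym2_iff.2 ⟨key p hp _ le_rfl h, key p hp _ (by omega) (by omega)⟩
    · rintro p - q - hpq
      have h : (p.1.1 : ℕ) < p.1.2 := p.2
      have h' : (q.1.1 : ℕ) < q.1.2 := q.2
      rw [Sym2.eq_iff] at hpq
      refine Subtype.ext (Prod.ext (Fin.ext ?_) (Fin.ext ?_)) <;> omega
  · refine ⟨(Finset.range x).attachFin fun k hk => (Finset.mem_range.1 hk).trans_le hx,
      Finset.univ.filter fun p => (p.1.2 : ℕ) ≤ x, by simp, ?_, ?_⟩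
    · intro p hp k hk
      rw [Finset.mem_filter_univ] at hp
      rw [Finset.mem_attachFin, Finset.mem_range]
      by_contra h
      refine hk (if_neg ?_)
      omega
    · rw [← Finset.card_range x, ← Finset.card_sym2]
      refine Finset.card_le_card_of_surjOn (fun p => s((p.1.1 : ℕ), (p.1.2 : ℕ) - 1)) ?_
      intro z
      induction z with | _ a b
      intro h
      obtain ⟨ha, hb⟩ := Finset.mk_mem_sym2_iff.1 h
      rw [Finset.mem_range] at ha hb
      rw [Finset.card_range]
      rcases le_total a b with hab | hab
      · exact ⟨⟨⟨⟨a, by omega⟩, ⟨b + 1, by omega⟩⟩, Nat.lt_succ_iff.2 hab⟩, by simpa using hb, rfl⟩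
      · exact ⟨⟨⟨⟨b, by omega⟩, ⟨a + 1, by omega⟩⟩, Nat.lt_succ_iff.2 hab⟩, by simpa using ha,
          Sym2.eq_swap⟩

theorem maxw0_B {n : ℕ} (cs : CoxeterSystem (CoxeterMatrix.B n) W) {x : ℕ} (hx : x ≤ n) :
    cs.maxw0 x = x ^ 2 := by
  classical
  refine cs.maxw0_eq_of_isPositiveRoots (isCartan_B n) (isPositiveRoots_B n) ?_ ?_
  · intro I s hI hs
    have hJ : (I.map Fin.valEmbedding).card = x := by rw [Finset.card_map, hI]
    rw [← hJ, sq, ← Finset.card_product]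
    have key : ∀ p ∈ s, ∀ k < n, coordB p.1.1 p.1.2.1 p.1.2.2 k ≠ 0 →
        k ∈ I.map Fin.valEmbedding := fun p hp k hk h =>
      Finset.mem_map.2 ⟨⟨k, hk⟩, hs p hp _ h, rfl⟩
    -- Roots e_a + e_b with `b < n` fill the pairs with first entry larger; the roots e_a - e_b and
    -- e_a fill the remaining ones.
    refine Finset.card_le_card_of_injOn (fun p => if p.1.2.2 = true ∧ (p.1.2.1 : ℕ) < n then
      ((p.1.2.1 : ℕ), (p.1.1 : ℕ)) else ((p.1.1 : ℕ), (p.1.2.1 : ℕ) - 1)) ?_ ?_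
    · rintro ⟨⟨a, b, s⟩, (hab : (a : ℕ) < b), hb⟩ hp
      have key := key _ hp
      dsimp only at key hb ⊢
      have h1 := key a (by omega) (by simp [coordB, hab])
      split_ifs with h
      · refine Finset.mem_product.2 ⟨key b h.2 ?_, h1⟩
        simp [coordB, h.1, hab.not_gt]
      · refine Finset.mem_product.2 ⟨h1, key _ (by omega) ?_⟩
        unfold coordB
        grind
    · rintro ⟨⟨a, b, s⟩, (hab : (a : ℕ) < b), hb⟩ - ⟨⟨a', b', s'⟩, (hab' : (a' : ℕ) < b'), hb'⟩ - h
      simp only [Subtype.mk.injEq, Prod.mk.injEq, Fin.ext_iff]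
      grind
  -- The last `x` nodes span a subdiagram B_x.
  · refine ⟨(Finset.Ico (n - x) n).attachFin fun k hk => (Finset.mem_Ico.1 hk).2,
      Finset.univ.filter fun p => n - x ≤ (p.1.1 : ℕ), by simp; omega, ?_, ?_⟩
    · intro p hp k hk
      rw [Finset.mem_filter_univ] at hp
      rw [Finset.mem_attachFin, Finset.mem_Ico]
      refine ⟨?_, k.2⟩
      by_contra h
      refine hk (if_pos ?_)
      omega
    · have hc : (Finset.Ico (n - x) n).card = x := by simp; omega
      conv_lhs => rw [← hc, sq, ← Finset.card_product]
      refine Finset.card_le_card_of_surjOn (fun p => if p.1.2.2 = true ∧ (p.1.2.1 : ℕ) < n then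
        ((p.1.2.1 : ℕ), (p.1.1 : ℕ)) else ((p.1.1 : ℕ), (p.1.2.1 : ℕ) - 1)) ?_
      rintro ⟨a, b⟩ h
      rw [Finset.mem_coe, Finset.mem_product, Finset.mem_Ico, Finset.mem_Ico] at h
      dsimp only at h
      rcases le_or_gt a b with hab | hab
      · refine ⟨⟨⟨⟨a, by omega⟩, ⟨b + 1, by omega⟩, decide (b + 1 = n)⟩, Nat.lt_succ_iff.2 hab, ?_⟩,
          ?_, ?_⟩
        · dsimp only
          grind
        · simp; omega
        · simp; omega
      · refine ⟨⟨⟨⟨b, by omega⟩, ⟨a, by omega⟩, true⟩, hab, Or.inl h.1.2⟩, ?_, ?_⟩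
        · simp; omega
        · simp; omega

/-- If `I` contains both ends of the fork, its roots inject into ordered pairs of distinct nodes of
`I`, as many as the roots of D_x. -/
theorem card_roots_D_le_of_mem {n x : ℕ} (hn : 3 ≤ n) (I : Finset (Fin n))
    (s : Finset {p : Fin n × Fin n × Bool // p.1 < p.2.1}) (hI : I.card = x)
    (hs : ∀ p ∈ s, ∀ k, rootD n p k ≠ 0 → k ∈ I) (h1 : n - 1 ∈ I.map Fin.valEmbedding)
    (h2 : n - 2 ∈ I.map Fin.valEmbedding) : s.card ≤ x ^ 2 - x := by
  classical
  have hJ : (I.map Fin.valEmbedding).card = x := by rw [Finset.card_map, hI]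
  have key : ∀ p ∈ s, ∀ k < n, coordD n p.1.1 p.1.2.1 p.1.2.2 k ≠ 0 →
      k ∈ I.map Fin.valEmbedding := fun p hp k hk h =>
    Finset.mem_map.2 ⟨⟨k, hk⟩, hs p hp _ h, rfl⟩
  generalize I.map Fin.valEmbedding = J at *
  rw [← hJ, sq, ← Finset.offDiag_card]
  -- The natural pair for e_a - e_b is (a, b), but `b` may lie outside `I`. Then (b - 1, a) serves
  -- instead, or (a, n - 1) when `b - 1 = a`.
  refine Finset.card_le_card_of_injOn (fun p => if p.1.2.2 = true then
    ((p.1.2.1 : ℕ), (p.1.1 : ℕ)) else if (p.1.2.1 : ℕ) ∈ J then ((p.1.1 : ℕ), (p.1.2.1 : ℕ))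
    else if (p.1.1 : ℕ) + 1 = p.1.2.1 then ((p.1.1 : ℕ), n - 1)
    else ((p.1.2.1 : ℕ) - 1, (p.1.1 : ℕ))) ?_ ?_
  · rintro ⟨⟨a, b, t⟩, (hab : (a : ℕ) < b)⟩ hp
    have key := key _ hp
    have ha := a.2
    have hb := b.2
    dsimp only at key ⊢
    rw [Finset.mem_coe]
    have haJ : (a : ℕ) ∈ J := by
      by_cases ha2 : (a : ℕ) + 2 = n
      · rwa [show (a : ℕ) = n - 2 by omega]
      · refine key a a.2 ?_
        unfold coordD
        grind
    have hbJ : t = true → (b : ℕ) ∈ J := by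
      intro ht
      by_cases hb2 : (b : ℕ) + 1 = n
      · rwa [show (b : ℕ) = n - 1 by omega]
      · refine key b b.2 ?_
        unfold coordD
        grind
    have hbJ' : t = false → (b : ℕ) - 1 ∈ J := by
      intro ht
      refine key _ (by omega) ?_
      unfold coordD
      grind
    have hb1 : (b : ℕ) ∉ J → (b : ℕ) < n - 2 := fun h => by
      by_contra hlt
      rcases (show (b : ℕ) = n - 1 ∨ (b : ℕ) = n - 2 by omega) with h' | h' <;> rw [h'] at h <;>
        contradiction
    split_ifs with h3 h4 h5 <;> rw [Finset.mem_offDiag] <;> dsimp only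
    · exact ⟨hbJ h3, haJ, by omega⟩
    · exact ⟨haJ, h4, by omega⟩
    · exact ⟨haJ, h1, by have := hb1 h4; omega⟩
    · exact ⟨hbJ' (by simpa using h3), haJ, by omega⟩
  · rintro ⟨⟨a, b, t⟩, (hab : (a : ℕ) < b)⟩ hp ⟨⟨a', b', t'⟩, (hab' : (a' : ℕ) < b')⟩ hp' h
    have hk := key _ hp
    have hk' := key _ hp'
    have hb := b.2
    have hb' := b'.2
    dsimp only at hk hk' h
    simp only [Subtype.mk.injEq, Prod.mk.injEq, Fin.ext_iff]
    have hb1 : ∀ c : ℕ, c < n → c ∉ J → c < n - 2 := fun c hc h => by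
      by_contra hlt
      rcases (show c = n - 1 ∨ c = n - 2 by omega) with h' | h' <;> rw [h'] at h <;>
        contradiction
    have e1 := hb1 b hb
    have e2 := hb1 b' hb'
    have f1 : t' = false → ∀ c, (a' : ℕ) ≤ c → c < b' → c ∈ J := fun ht c h3 h4 =>
      hk' c (by omega) (by simp [coordD, ht, h3, h4])
    have f2 : t = false → ∀ c, (a : ℕ) ≤ c → c < b → c ∈ J := fun ht c h3 h4 =>
      hk c (by omega) (by simp [coordD, ht, h3, h4])
    have g1 : t' = true → ∀ c, (a' : ℕ) ≤ c → c < n - 2 → c ∈ J := fun ht c h3 h4 =>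
      hk' c (by omega) (by unfold coordD; grind)
    have g2 : t = true → ∀ c, (a : ℕ) ≤ c → c < n - 2 → c ∈ J := fun ht c h3 h4 =>
      hk c (by omega) (by unfold coordD; grind)
    -- A clash between a substitute pair and a natural one would put the missing `b` in the support
    -- of the other root, hence in `J`.
    have f1' := fun ht => f1 ht b
    have f2' := fun ht => f2 ht b'
    have g1' := fun ht => g1 ht b
    have g2' := fun ht => g2 ht b'
    clear f1 f2 g1 g2 hk hk' key hs hb1
    cases t <;> cases t' <;> split_ifs at h <;> grind

/-- Without one end of the fork `I` lies in a path, so the type A count by ends of supports applies.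
-/
theorem card_roots_D_le_of_notMem {n x : ℕ} (I : Finset (Fin n))
    (s : Finset {p : Fin n × Fin n × Bool // p.1 < p.2.1}) (hI : I.card = x)
    (hs : ∀ p ∈ s, ∀ k, rootD n p k ≠ 0 → k ∈ I)
    (h : n - 1 ∉ I.map Fin.valEmbedding ∨ n - 2 ∉ I.map Fin.valEmbedding) :
    s.card ≤ (x + 1).choose 2 := by
  classical
  have hJ : (I.map Fin.valEmbedding).card = x := by rw [Finset.card_map, hI]
  have key : ∀ p ∈ s, ∀ k < n, coordD n p.1.1 p.1.2.1 p.1.2.2 k ≠ 0 →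
      k ∈ I.map Fin.valEmbedding := fun p hp k hk h =>
    Finset.mem_map.2 ⟨⟨k, hk⟩, hs p hp _ h, rfl⟩
  generalize I.map Fin.valEmbedding = J at *
  rw [← hJ, ← Finset.card_sym2]
  have hlast : ∀ p ∈ s, p.1.2.2 = true → n - 1 ∈ J ∧ (p.1.2.1 : ℕ) + 1 = n := by
    rintro ⟨⟨a, b, t⟩, (hab : (a : ℕ) < b)⟩ hp (ht : t = true)
    have key := key _ hp
    have hb := b.2
    dsimp only at key ⊢
    have h1 : n - 1 ∈ J := key _ (by omega) (by unfold coordD; grind)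
    refine ⟨h1, ?_⟩
    by_contra hb1
    rcases h with h | h
    · exact h h1
    · exact h (key _ (by omega) (by unfold coordD; grind))
  -- The root e_a + e_{n-1} is supported on `a`, …, `n - 3` and `n - 1`, except that for `a = n - 2`
  -- it is the simple root of node `n - 1`.
  refine Finset.card_le_card_of_injOn (fun p => if p.1.2.2 = true then
    s(if (p.1.1 : ℕ) + 2 = n then n - 1 else (p.1.1 : ℕ), n - 1)
    else s((p.1.1 : ℕ), (p.1.2.1 : ℕ) - 1)) ?_ ?_
  · rintro ⟨⟨a, b, t⟩, (hab : (a : ℕ) < b)⟩ hp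
    have key := key _ hp
    have hb := b.2
    have hlast := hlast _ hp
    dsimp only at key hlast ⊢
    rw [Finset.mem_coe]
    split_ifs with h3 h4 <;> rw [Finset.mk_mem_sym2_iff]
    · exact ⟨(hlast h3).1, (hlast h3).1⟩
    · exact ⟨key _ a.2 (by unfold coordD; grind), (hlast h3).1⟩
    · exact ⟨key _ a.2 (by unfold coordD; grind), key _ (by omega) (by unfold coordD; grind)⟩
  · rintro ⟨⟨a, b, t⟩, (hab : (a : ℕ) < b)⟩ hp ⟨⟨a', b', t'⟩, (hab' : (a' : ℕ) < b')⟩ hp' h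
    have hlast1 := hlast _ hp
    have hlast2 := hlast _ hp'
    have hb := b.2
    have hb' := b'.2
    dsimp only at h hlast1 hlast2
    simp only [Subtype.mk.injEq, Prod.mk.injEq, Fin.ext_iff]
    clear key hs hlast
    cases t <;> cases t' <;> split_ifs at h <;> rw [Sym2.eq_iff] at h <;> grind

theorem succ_choose_two_le {x : ℕ} (hx : 3 ≤ x) : (x + 1).choose 2 ≤ x ^ 2 - x := by
  obtain ⟨y, rfl⟩ := Nat.exists_eq_add_of_le hx
  rw [Nat.choose_two_right]
  refine Nat.div_le_of_le_mul ?_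
  have : (3 + y) ^ 2 - (3 + y) = (3 + y) * (2 + y) := by
    rw [Nat.sub_eq_iff_eq_add (by nlinarith)]
    ring
  rw [this, show 3 + y + 1 - 1 = 3 + y by omega]
  nlinarith

theorem maxw0_D {n : ℕ} (hn : 3 ≤ n) (cs : CoxeterSystem (coxeterD n) W) {x : ℕ} (hx : x ≤ n) :
    cs.maxw0 x = if 3 < x then x ^ 2 - x else (x + 1).choose 2 := by
  classical
  refine cs.maxw0_eq_of_isPositiveRoots (isCartan_D n) (isPositiveRoots_D n hn) ?_ ?_
  · intro I s hI hs
    by_cases h : n - 1 ∈ I.map Fin.valEmbedding ∧ n - 2 ∈ I.map Fin.valEmbedding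
    · refine (card_roots_D_le_of_mem hn I s hI hs h.1 h.2).trans ?_
      split_ifs with h3
      · rfl
      · interval_cases x <;> decide
    · refine (card_roots_D_le_of_notMem I s hI hs (not_and_or.1 h)).trans ?_
      split_ifs with h3
      · exact succ_choose_two_le (by omega)
      · rfl
  -- For `x ≥ 3` the last `x` nodes form D_x, where D_3 = A_3 makes both formulas give 6; for
  -- smaller `x` the first `x` nodes form a path.
  by_cases hx3 : 3 ≤ x
  · refine ⟨(Finset.Ico (n - x) n).attachFin fun k hk => (Finset.mem_Ico.1 hk).2,
      Finset.univ.filter fun p => n - x ≤ (p.1.1 : ℕ), by simp; omega, ?_, ?_⟩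
    · intro p hp k hk
      rw [Finset.mem_filter_univ] at hp
      rw [Finset.mem_attachFin, Finset.mem_Ico]
      refine ⟨?_, k.2⟩
      by_contra h
      refine hk ?_
      have : (p.1.1 : ℕ) < p.1.2.1 := p.2
      unfold rootD coordD
      grind
    · have hc : (Finset.Ico (n - x) n).card = x := by simp; omega
      have hN : (if 3 < x then x ^ 2 - x else (x + 1).choose 2) = x ^ 2 - x := by
        split_ifs with h
        · rfl
        · obtain rfl : x = 3 := by omega
          decide
      rw [hN]
      conv_lhs => rw [← hc, sq, ← Finset.offDiag_card]
      refine Finset.card_le_card_of_surjOn (fun p => if p.1.2.2 = true then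
        ((p.1.2.1 : ℕ), (p.1.1 : ℕ)) else ((p.1.1 : ℕ), (p.1.2.1 : ℕ))) ?_
      rintro ⟨a, b⟩ h
      rw [Finset.mem_coe, Finset.mem_offDiag, Finset.mem_Ico, Finset.mem_Ico] at h
      dsimp only at h
      rcases lt_or_ge a b with hab | hab
      · exact ⟨⟨⟨⟨a, by omega⟩, ⟨b, by omega⟩, false⟩, hab⟩, by simp; omega, by simp⟩
      · exact ⟨⟨⟨⟨b, by omega⟩, ⟨a, by omega⟩, true⟩, Fin.lt_def.2 (lt_of_le_of_ne hab h.2.2.symm)⟩,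
          by simp; omega, by simp⟩
  · refine ⟨(Finset.range x).attachFin fun k hk => (Finset.mem_range.1 hk).trans_le hx,
      Finset.univ.filter fun p => (p.1.2.1 : ℕ) ≤ x ∧ p.1.2.2 = false, by simp, ?_, ?_⟩
    · intro p hp k hk
      rw [Finset.mem_filter_univ] at hp
      rw [Finset.mem_attachFin, Finset.mem_range]
      by_contra h
      refine hk ?_
      unfold rootD coordD
      grind
    · rw [if_neg (by omega)]
      conv_lhs => rw [← Finset.card_range x, ← Finset.card_sym2]
      refine Finset.card_le_card_of_surjOn (fun p => s((p.1.1 : ℕ), (p.1.2.1 : ℕ) - 1)) ?_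
      intro z
      induction z with | _ a b
      intro h
      obtain ⟨ha, hb⟩ := Finset.mk_mem_sym2_iff.1 h
      rw [Finset.mem_range] at ha hb
      rcases le_total a b with hab | hab
      · exact ⟨⟨⟨⟨a, by omega⟩, ⟨b + 1, by omega⟩, false⟩, Nat.lt_succ_iff.2 hab⟩,
          by simpa using hb, rfl⟩
      · exact ⟨⟨⟨⟨b, by omega⟩, ⟨a + 1, by omega⟩, false⟩, Nat.lt_succ_iff.2 hab⟩,
          by simpa using ha, Sym2.eq_swap⟩

end CoxeterSystem

/-! ### Roots coded by digits, and the finite check -/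

section DigitCodes

/-- The digit of `c` at position `k` in base `b`. -/
def digitAt (b c k : ℕ) : ℕ := c / b ^ k % b

theorem eq_of_digitAt_eq {b n c c' : ℕ} (hc : c < b ^ n) (hc' : c' < b ^ n)
    (h : ∀ k < n, digitAt b c k = digitAt b c' k) : c = c' := by
  have key : ∀ m ≤ n, c % b ^ m = c' % b ^ m := by
    intro m
    induction m with
    | zero => simp [Nat.mod_one]
    | succ m ih =>
      intro hm
      have := h m (by omega)
      unfold digitAt at this
      rw [Nat.mod_pow_succ, Nat.mod_pow_succ, ih (by omega), this]
  simpa [Nat.mod_eq_of_lt hc, Nat.mod_eq_of_lt hc'] using key n le_rfl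

variable {n : ℕ} {K : Type*} [CommRing K]

/-- The vector whose coordinates are the digits of `c`, read through `val`. -/
def digitVec (n b : ℕ) (val : ℕ → K) (c : ℕ) (k : Fin n) : K := val (digitAt b c k)

/-- The number obtained from `c` by replacing its digit at position `i` by `d`. -/
def replaceDigit (b c i d : ℕ) : ℕ := c % b ^ i + b ^ i * (d + b * (c / b ^ (i + 1)))

/-- A digit below position `i` is read from the remainder modulo `b ^ i`, one above it from the
quotient by `b ^ (i + 1)`. -/
theorem digitAt_eq_of_ne {b c c' i k : ℕ} (h1 : c % b ^ i = c' % b ^ i)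
    (h2 : c / b ^ (i + 1) = c' / b ^ (i + 1)) (hk : k ≠ i) : digitAt b c k = digitAt b c' k := by
  unfold digitAt
  rcases lt_or_gt_of_ne hk with h | h
  · obtain ⟨d, rfl⟩ := Nat.exists_eq_add_of_lt h
    have key : ∀ a : ℕ, a / b ^ k % b = a % b ^ (k + d + 1) / b ^ k % b := fun a => by
      rw [add_assoc, pow_add, Nat.mod_mul_right_div_self, pow_succ, Nat.mod_mul_left_mod]
    rw [key, h1, ← key]
  · obtain ⟨d, rfl⟩ := Nat.exists_eq_add_of_lt h
    have key : ∀ a : ℕ, a / b ^ (i + d + 1) = a / b ^ (i + 1) / b ^ d := fun a => by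
      rw [Nat.div_div_eq_div_mul, ← pow_add]
      congr 2
      omega
    rw [key, h2, ← key]

theorem digitAt_replaceDigit_of_ne {b c i k d : ℕ} (hd : d < b) (hk : k ≠ i) :
    digitAt b (replaceDigit b c i d) k = digitAt b c k := by
  have hb : 0 < b ^ i := Nat.pow_pos (by omega)
  refine digitAt_eq_of_ne ?_ ?_ hk <;> rw [replaceDigit]
  · rw [Nat.add_mul_mod_self_left, Nat.mod_mod]
  · rw [pow_succ, ← Nat.div_div_eq_div_mul, Nat.add_mul_div_left _ _ hb,
      Nat.div_eq_of_lt (Nat.mod_lt _ hb), zero_add, Nat.add_mul_div_left _ _ (by omega),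
      Nat.div_eq_of_lt hd, zero_add]

theorem digitAt_replaceDigit {b c i d : ℕ} (hd : d < b) :
    digitAt b (replaceDigit b c i d) i = d := by
  have hb : 0 < b ^ i := Nat.pow_pos (by omega)
  rw [replaceDigit, digitAt, Nat.add_mul_div_left _ _ hb, Nat.div_eq_of_lt (Nat.mod_lt _ hb),
    zero_add, Nat.add_mul_mod_self_left, Nat.mod_eq_of_lt hd]

/-- The coordinate `i` of the reflection in the simple root `i` of the vector with code `c`. -/
def reflectedCoord (b : ℕ) (val : ℕ → K) (A : Matrix (Fin n) (Fin n) K) (c : ℕ) (i : Fin n) : K :=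
  val (digitAt b c i) - ((List.finRange n).map fun j => A i j * val (digitAt b c j)).sum

/-- The digit for `reflectedCoord`, where `code` turns coordinates into digits. -/
def reflectedDigit (b : ℕ) (val : ℕ → K) (code : K → ℕ) (A : Matrix (Fin n) (Fin n) K) (c : ℕ)
    (i : Fin n) : ℕ :=
  code (reflectedCoord b val A c i)

/-- Decidable conditions under which the codes in `L` stand for the positive roots of `A`. -/
structure IsRootCode (b : ℕ) (val : ℕ → K) (code : K → ℕ) (A : Matrix (Fin n) (Fin n) K)
    (L : List ℕ) : Prop where
  lt : ∀ c ∈ L, c < b ^ n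
  notMem : 0 ∉ L
  simple : ∀ i : Fin n, b ^ (i : ℕ) ∈ L
  reflection : ∀ c ∈ L, ∀ i : Fin n, c = b ^ (i : ℕ) ∨
    reflectedDigit b val code A c i < b ∧
    val (reflectedDigit b val code A c i) = reflectedCoord b val A c i ∧
    replaceDigit b c i (reflectedDigit b val code A c i) ∈ L

theorem digitVec_pow {b : ℕ} (hb : 1 < b) (val : ℕ → K) (h0 : val 0 = 0) (h1 : val 1 = 1)
    (i : Fin n) : digitVec n b val (b ^ (i : ℕ)) = Pi.single i 1 := by
  ext k
  rw [digitVec, digitAt, Pi.single_apply]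
  split_ifs with h
  · rw [h, Nat.div_self (by positivity), Nat.mod_eq_of_lt hb, h1]
  · rcases lt_or_gt_of_ne fun h' => h (Fin.ext h') with h | h
    · rw [Nat.pow_div h.le (by omega), Nat.mod_eq_zero_of_dvd, h0]
      exact dvd_pow_self b (by omega)
    · rw [Nat.div_eq_of_lt (Nat.pow_lt_pow_right hb h), Nat.zero_mod, h0]

/-- Nothing is assumed of `code`: the field `reflection` verifies that each digit it proposes
represents the reflected coordinate. Injectivity and nonvanishing come from uniqueness of digits. -/
theorem IsRootCode.isPositiveRoots {b : ℕ} {val : ℕ → K} {code : K → ℕ}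
    {A : Matrix (Fin n) (Fin n) K} {L : List ℕ} (h : IsRootCode b val code A L) (hb : 1 < b)
    {C : Subsemiring K} (hC : ∀ x ∈ C, -x ∈ C → x = 0) (hval : ∀ d, val d ∈ C)
    (hinj : ∀ d < b, ∀ d' < b, val d = val d' → d = d') (h0 : val 0 = 0) (h1 : val 1 = 1) :
    IsPositiveRoots C A fun c : L.toFinset => digitVec n b val c := by
  have hlt : ∀ c ∈ L.toFinset, c < b ^ n := fun c hc => h.lt c (List.mem_toFinset.1 hc)
  have key : ∀ c c', c < b ^ n → c' < b ^ n → digitVec n b val c = digitVec n b val c' → c = c' :=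
    fun c c' hc hc' hcc => eq_of_digitAt_eq hc hc' fun k hk =>
      hinj _ (Nat.mod_lt _ (by omega)) _ (Nat.mod_lt _ (by omega)) (congrFun hcc ⟨k, hk⟩)
  refine ⟨hC, ?_, fun p k => hval _, ?_, ?_, ?_⟩
  · rintro ⟨c, hc⟩ ⟨c', hc'⟩ hcc
    exact Subtype.ext (key c c' (hlt c hc) (hlt c' hc') hcc)
  · rintro ⟨c, hc⟩ hcc
    have := key c 0 (hlt c hc) (by positivity) (hcc.trans (funext fun k => by
      simp [digitVec, digitAt, h0]))
    subst this
    exact h.notMem (List.mem_toFinset.1 hc)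
  · exact fun i => ⟨⟨b ^ (i : ℕ), List.mem_toFinset.2 (h.simple i)⟩, digitVec_pow hb val h0 h1 i⟩
  · rintro i ⟨c, hc⟩ hne
    rcases h.reflection c (List.mem_toFinset.1 hc) i with hci | ⟨h2, h3, h4⟩
    · subst hci
      exact absurd (digitVec_pow hb val h0 h1 i) hne
    · refine ⟨⟨_, List.mem_toFinset.2 h4⟩, funext fun k => ?_⟩
      rw [CoxeterMatrix.cartanReflection_apply]
      by_cases hk : k = i
      · subst hk
        simpa [Matrix.mulVec, dotProduct, digitVec, digitAt_replaceDigit h2, reflectedCoord,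
          Fin.sum_univ_def] using h3
      · have : (k : ℕ) ≠ i := fun h' => hk (Fin.ext h')
        simp [hk, digitVec, digitAt_replaceDigit_of_ne h2 this]

/-- The number of codes in `L` all of whose nonzero digits are at positions in the binary
expansion of `m`. -/
def countWithin (n b : ℕ) (L : List ℕ) (m : ℕ) : ℕ :=
  L.countP fun c => (List.range n).all fun k => digitAt b c k == 0 || m.testBit k

/-- The number of binary digits `1` of `m` among the lowest `n`. -/
def bitCount (n m : ℕ) : ℕ := (List.range n).countP m.testBit

/-- For every choice of positions below the first argument, the codes in `L` without other nonzero
digits there number at most `table (x + j)`, where `j` is the number of chosen positions. -/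
def boundedBy (table : ℕ → ℕ) (b : ℕ) : ℕ → ℕ → List ℕ → Bool
  | 0, x, L => decide (L.length ≤ table x)
  | k + 1, x, L => boundedBy table b k (x + 1) L &&
      boundedBy table b k x (L.filter fun c => digitAt b c k == 0)

/-- The recursion decides the highest position first, so that subsets agreeing on high positions
share one filtered list. -/
theorem countWithin_le_of_boundedBy {table : ℕ → ℕ} {b n x : ℕ} {L : List ℕ}
    (h : boundedBy table b n x L = true) (m : ℕ) :
    countWithin n b L m ≤ table (x + bitCount n m) := by
  induction n generalizing x L with
  | zero => simpa [boundedBy, countWithin, bitCount] using h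
  | succ k ih =>
    rw [boundedBy, Bool.and_eq_true] at h
    cases hk : m.testBit k
    · refine le_trans (le_of_eq ?_) ((ih h.2).trans_eq ?_)
      · simp [countWithin, List.range_succ, hk, List.countP_filter]
      · simp [bitCount, List.range_succ, hk]
    · refine le_trans (le_of_eq ?_) ((ih h.1).trans_eq ?_)
      · simp [countWithin, List.range_succ, hk]
      · simp [bitCount, List.range_succ, hk, add_comm, add_left_comm]

theorem exists_testBit_iff (I : Finset (Fin n)) :
    ∃ m : ℕ, ∀ k : Fin n, m.testBit k = true ↔ k ∈ I := by
  refine ⟨Nat.ofBits fun k => decide (k ∈ I), fun k => ?_⟩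
  rw [Nat.testBit_ofBits_lt _ _ k.2]
  simp

theorem card_eq_bitCount {I : Finset (Fin n)} {m : ℕ}
    (hm : ∀ k : Fin n, m.testBit k = true ↔ k ∈ I) : I.card = bitCount n m := by
  have : I.map Fin.valEmbedding = (Finset.range n).filter fun k => m.testBit k = true := by
    ext k
    simp only [Finset.mem_map, Finset.mem_filter, Finset.mem_range]
    constructor
    · rintro ⟨k, hk, rfl⟩
      exact ⟨k.2, (hm k).2 hk⟩
    · rintro ⟨hk, h⟩
      exact ⟨⟨k, hk⟩, (hm _).1 h, rfl⟩
  rw [← Finset.card_map Fin.valEmbedding, this, bitCount, List.countP_eq_length_filter,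
    ← List.toFinset_card_of_nodup (List.nodup_range.filter _), List.toFinset_filter,
    List.toFinset_range]

/-- Subsets of nodes become bit masks. As `val` vanishes only at the digit 0, supports of roots are
read off the digits; `hle` bounds every mask and `hge` supplies an optimal one. -/
theorem CoxeterSystem.maxw0_eq_of_isRootCode {W : Type*} [Group W] [Finite W]
    {M : CoxeterMatrix (Fin n)} (cs : CoxeterSystem M W) {b : ℕ} {val : ℕ → K}
    {code : K → ℕ} {A : Matrix (Fin n) (Fin n) K} {L : List ℕ} {C : Subsemiring K}
    (hA : M.IsCartan C A) (h : IsRootCode b val code A L) (hb : 1 < b)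
    (hC : ∀ x ∈ C, -x ∈ C → x = 0) (hval : ∀ d, val d ∈ C)
    (hinj : ∀ d < b, ∀ d' < b, val d = val d' → d = d') (h0 : val 0 = 0) (h1 : val 1 = 1)
    (hL : L.Nodup) {table : ℕ → ℕ}
    (hle : boundedBy table b n 0 L = true)
    (hge : ∀ x ≤ n, ∃ m < 2 ^ n, bitCount n m = x ∧ countWithin n b L m = table x)
    {x : ℕ} (hx : x ≤ n) : cs.maxw0 x = table x := by
  classical
  have hz : ∀ c k, val (digitAt b c k) = 0 ↔ digitAt b c k = 0 := fun c k =>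
    ⟨fun hv => hinj _ (Nat.mod_lt _ (by omega)) _ (by omega) (hv.trans h0.symm),
      fun hv => by rw [hv, h0]⟩
  have hcond : ∀ (I : Finset (Fin n)) (m : ℕ), (∀ k : Fin n, m.testBit k = true ↔ k ∈ I) → ∀ c,
      ((∀ k, digitVec n b val c k ≠ 0 → k ∈ I) ↔
        ((List.range n).all fun k => digitAt b c k == 0 || m.testBit k) = true) := by
    intro I m hm c
    simp only [List.all_eq_true, List.mem_range, Bool.or_eq_true, beq_iff_eq, digitVec]
    constructor
    · intro hk k hkn
      by_contra hcon
      rw [not_or] at hcon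
      exact hcon.2 ((hm ⟨k, hkn⟩).2 (hk ⟨k, hkn⟩ fun h' => hcon.1 ((hz c k).1 h')))
    · intro hk k hne
      exact (hm k).1 ((hk k k.2).resolve_left fun h' => hne ((hz c k).2 h'))
  have hcount : ∀ m : ℕ, countWithin n b L m = (L.toFinset.filter fun c =>
      ((List.range n).all fun k => digitAt b c k == 0 || m.testBit k) = true).card := by
    intro m
    rw [countWithin, List.countP_eq_length_filter, ← List.toFinset_filter,
      List.toFinset_card_of_nodup (hL.filter _)]
  refine cs.maxw0_eq_of_isPositiveRoots hA (h.isPositiveRoots hb hC hval hinj h0 h1) ?_ ?_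
  · intro I s hI hs
    obtain ⟨m, hmI⟩ := exists_testBit_iff I
    refine le_trans ?_ ((countWithin_le_of_boundedBy hle m).trans_eq
      (by rw [← card_eq_bitCount hmI, hI, zero_add]))
    rw [hcount, ← Finset.card_map (Function.Embedding.subtype _)]
    refine Finset.card_le_card fun c hc => ?_
    obtain ⟨p, hp, rfl⟩ := Finset.mem_map.1 hc
    exact Finset.mem_filter.2 ⟨p.2, (hcond I m hmI _).1 (hs p hp)⟩
  · obtain ⟨m, -, hmx, hmL⟩ := hge x hx
    have hmI : ∀ k : Fin n, m.testBit k = true ↔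
        k ∈ (Finset.univ.filter fun k : Fin n => m.testBit k = true) := by simp
    refine ⟨_, Finset.univ.filter fun p => ((List.range n).all fun k =>
      digitAt b p k == 0 || m.testBit k) = true, (card_eq_bitCount hmI).trans hmx, ?_, ?_⟩
    · intro p hp
      exact (hcond _ m hmI _).2 (by simpa using hp)
    · rw [← hmL, hcount, ← Finset.card_map (Function.Embedding.subtype _)]
      refine Finset.card_le_card fun c hc => ?_
      obtain ⟨hc1, hc2⟩ := Finset.mem_filter.1 hc
      exact Finset.mem_map.2 ⟨⟨c, hc1⟩, (Finset.mem_filter_univ _).2 hc2, rfl⟩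

end DigitCodes

/-! ### Types E, F, H -/

section ExceptionalTypes

/-- The positive roots of type `E₈`; the digits are the coordinates. -/
def rootsE : List ℕ := [
  1, 10, 100, 101, 1000, 1010, 1100, 1101, 1110, 1111, 10000, 11000, 11010, 11100, 11101, 11110,
  11111, 12110, 12111, 12211, 100000, 110000, 111000, 111010, 111100, 111101, 111110, 111111,
  112110, 112111, 112211, 122110, 122111, 122211, 123211, 123221, 1000000, 1100000, 1110000,
  1111000, 1111010, 1111100, 1111101, 1111110, 1111111, 1112110, 1112111, 1112211, 1122110,
  1122111, 1122211, 1123211, 1123221, 1222110, 1222111, 1222211, 1223211, 1223221, 1233211,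
  1233221, 1234221, 1234321, 1234322, 10000000, 11000000, 11100000, 11110000, 11111000, 11111010,
  11111100, 11111101, 11111110, 11111111, 11112110, 11112111, 11112211, 11122110, 11122111,
  11122211, 11123211, 11123221, 11222110, 11222111, 11222211, 11223211, 11223221, 11233211,
  11233221, 11234221, 11234321, 11234322, 12222110, 12222111, 12222211, 12223211, 12223221,
  12233211, 12233221, 12234221, 12234321, 12234322, 12333211, 12333221, 12334221, 12334321,
  12334322, 12344221, 12344321, 12344322, 12345321, 12345322, 12345331, 12345332, 12345422,
  12345432, 12346432, 12356432, 12456432, 13456432, 23456432]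

/-- The positive roots of type `F₄`; the digits are the coordinates. -/
def rootsF : List ℕ := [
  1, 10, 11, 100, 110, 111, 120, 121, 122, 1000, 1100, 1110, 1111, 1120, 1121, 1122, 1220, 1221,
  1222, 1231, 1232, 1242, 1342, 2342]

/-- The positive roots of type `H₄`; the base `100` digits `10 * b + a` stand for the coordinates
`a + b * φ`, where `φ ^ 2 = φ + 1`. -/
def rootsH : List ℕ := [
  1, 100, 101, 10000, 10100, 10101, 1000000, 1100000, 1101000, 1101010, 10010000, 10010100,
  10010101, 10100000, 10101000, 10101010, 10110100, 10110101, 10111000, 10111010, 10111101,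
  10111110, 11110100, 11110101, 11111000, 11111010, 11111101, 11111110, 11201000, 11201010,
  11202010, 11211101, 11211110, 11212010, 21211101, 21211110, 21212010, 21221101, 21221110,
  21221201, 21221211, 21222110, 21222111, 21312010, 21312110, 21312111, 22312010, 22312110,
  22312111, 22322110, 22322111, 22322211, 31322110, 31322111, 31322211, 31332211, 32332211,
  32422211, 32423111, 32423120]
/-- The symmetric generalized Cartan matrix of `M`, where `φ` is used for the entry `5`. -/
def symmCartanMatrix {B K : Type*} [CommRing K] (φ : K) (M : CoxeterMatrix B) : Matrix B B K :=
  Matrix.of fun i j =>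
    if M i j = 1 then 2 else if M i j = 2 then 0 else if M i j = 3 then -1 else -φ

theorem isCartan_symm {B K : Type*} [CommRing K] {φ : K} {C : Subsemiring K} {M : CoxeterMatrix B}
    (h : ∀ i j, i ≠ j → M i j = 2 ∨ M i j = 3 ∨ (M i j = 5 ∧ φ ∈ C ∧ φ ^ 2 = φ + 1)) :
    M.IsCartan C (symmCartanMatrix φ M) where
  diag i := by simp [symmCartanMatrix]
  pair i j hij := by
    unfold CoxeterMatrix.IsCartanPair symmCartanMatrix
    simp only [Matrix.of_apply, M.symmetric j i]
    rcases h i j hij with h | h | ⟨h, h1, h2⟩ <;> rw [h]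
    · exact Or.inl (by norm_num)
    · exact Or.inr (Or.inl (by norm_num))
    · exact Or.inr (Or.inr (Or.inr ⟨rfl, φ, h1, h2, by norm_num, by norm_num⟩))

/-- A generalized Cartan matrix of type `F₄`. -/
def cartanMatrixF : Matrix (Fin 4) (Fin 4) ℤ :=
  !![2, -1, 0, 0; -1, 2, -2, 0; 0, -1, 2, -1; 0, 0, -1, 2]

theorem isCartan_F : CoxeterMatrix.F₄.IsCartan (Subsemiring.nonneg ℤ) cartanMatrixF where
  diag := by decide
  pair i j hij := by
    have h : ∀ i j : Fin 4, i ≠ j →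
        (CoxeterMatrix.F₄ i j, cartanMatrixF i j, cartanMatrixF j i) ∈
          [(2, 0, 0), (3, -1, -1), (4, -1, -2), (4, -2, -1)] := by decide +kernel
    have := h i j hij
    simp only [List.mem_cons, List.not_mem_nil, or_false, Prod.mk.injEq] at this
    rcases this with h | h | h | h
    · exact Or.inl h
    · exact Or.inr (Or.inl h)
    · exact Or.inr (Or.inr (Or.inl ⟨h.1, Or.inl h.2⟩))
    · exact Or.inr (Or.inr (Or.inl ⟨h.1, Or.inr h.2⟩))

/-- The label 5 does not occur, so the value 0 for φ is a placeholder. -/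
theorem maxw0_E {n : ℕ} {W : Type*} [Group W] [Finite W] {M : CoxeterMatrix (Fin n)}
    (cs : CoxeterSystem M W) (hM : ∀ p : Fin n × Fin n, p.1 ≠ p.2 → M p.1 p.2 ∈ [2, 3])
    {L : List ℕ} (h : IsRootCode 10 (Nat.cast : ℕ → ℤ) Int.toNat (symmCartanMatrix 0 M) L)
    (hL : L.Nodup) (hle : boundedBy tableE 10 n 0 L = true)
    (hge : ∀ x ≤ n, ∃ m < 2 ^ n, bitCount n m = x ∧ countWithin n 10 L m = tableE x)
    {x : ℕ} (hx : x ≤ n) : cs.maxw0 x = tableE x := by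
  refine cs.maxw0_eq_of_isRootCode (C := Subsemiring.nonneg ℤ)
    (isCartan_symm fun i j hij => (show _ ∨ _ by simpa using hM (i, j) hij).imp_right Or.inl)
    h (by norm_num) ?_ ?_ ?_ rfl rfl hL hle hge hx
  · intro x hx hx'
    rw [Subsemiring.mem_nonneg] at hx hx'
    omega
  · exact fun d => by simp
  · exact fun d _ d' _ h => by exact_mod_cast h

theorem maxw0_E₆ {W : Type*} [Group W] [Finite W] (cs : CoxeterSystem CoxeterMatrix.E₆ W) {x : ℕ}
    (hx : x ≤ 6) : cs.maxw0 x = tableE x :=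
  -- The first six nodes of E_8 span E_6, and codes below `10 ^ 6` are the roots supported there.
  maxw0_E (L := rootsE.filter (· < 10 ^ 6)) cs (by decide +kernel)
    ⟨by decide +kernel, by decide +kernel, by decide +kernel, by decide +kernel⟩
    (by decide +kernel) (by decide +kernel) (by decide +kernel) hx

theorem maxw0_E₇ {W : Type*} [Group W] [Finite W] (cs : CoxeterSystem CoxeterMatrix.E₇ W) {x : ℕ}
    (hx : x ≤ 7) : cs.maxw0 x = tableE x :=
  maxw0_E (L := rootsE.filter (· < 10 ^ 7)) cs (by decide +kernel)
    ⟨by decide +kernel, by decide +kernel, by decide +kernel, by decide +kernel⟩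
    (by decide +kernel) (by decide +kernel) (by decide +kernel) hx

theorem maxw0_E₈ {W : Type*} [Group W] [Finite W] (cs : CoxeterSystem CoxeterMatrix.E₈ W) {x : ℕ}
    (hx : x ≤ 8) : cs.maxw0 x = tableE x :=
  maxw0_E (L := rootsE) cs (by decide +kernel)
    ⟨by decide +kernel, by decide +kernel, by decide +kernel, by decide +kernel⟩
    (by decide +kernel) (by decide +kernel) (by decide +kernel) hx

theorem maxw0_F₄ {W : Type*} [Group W] [Finite W] (cs : CoxeterSystem CoxeterMatrix.F₄ W) {x : ℕ}
    (hx : x ≤ 4) : cs.maxw0 x = tableF x := by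
  refine cs.maxw0_eq_of_isRootCode (table := tableF) (L := rootsF) (b := 10) (val := Nat.cast)
    (code := Int.toNat) isCartan_F
    ⟨by decide +kernel, by decide +kernel, by decide +kernel, by decide +kernel⟩
    (by norm_num) ?_ ?_ ?_ rfl rfl (by decide +kernel) (by decide +kernel) (by decide +kernel) hx
  · intro x hx hx'
    rw [Subsemiring.mem_nonneg] at hx hx'
    omega
  · exact fun d => by simp
  · exact fun d _ d' _ h => by exact_mod_cast h

/-- The elements `a + b * φ` of `ℤ[φ]`, `φ ^ 2 = φ + 1`, with `a` and `b` nonnegative. -/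
def goldenNonneg : Subsemiring (QuadraticAlgebra ℤ 1 1) where
  carrier := {z | 0 ≤ z.re ∧ 0 ≤ z.im}
  mul_mem' {y z} hy hz := by
    obtain ⟨h1, h2⟩ := hy
    obtain ⟨h3, h4⟩ := hz
    -- (a + bφ)(c + dφ) = (ac + bd) + (ad + bc + bd)φ.
    constructor <;> simp <;> positivity
  one_mem' := ⟨zero_le_one, le_rfl⟩
  add_mem' {y z} hy hz := ⟨add_nonneg hy.1 hz.1, add_nonneg hy.2 hz.2⟩
  zero_mem' := by simp

/-- The element `a + b * φ` for the two-digit number with digits `b` and `a`. -/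
def goldenVal (d : ℕ) : QuadraticAlgebra ℤ 1 1 := ⟨(d % 10 : ℕ), (d / 10 : ℕ)⟩

/-- An inverse of `goldenVal`. -/
def goldenCode (z : QuadraticAlgebra ℤ 1 1) : ℕ := 10 * z.im.toNat + z.re.toNat

theorem maxw0_H {n : ℕ} {W : Type*} [Group W] [Finite W] {M : CoxeterMatrix (Fin n)}
    (cs : CoxeterSystem M W) (hM : ∀ p : Fin n × Fin n, p.1 ≠ p.2 → M p.1 p.2 ∈ [2, 3, 5])
    {L : List ℕ} (h : IsRootCode 100 goldenVal goldenCode (symmCartanMatrix ⟨0, 1⟩ M) L)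
    (hL : L.Nodup)
    (hle : boundedBy tableH 100 n 0 L = true)
    (hge : ∀ x ≤ n, ∃ m < 2 ^ n, bitCount n m = x ∧ countWithin n 100 L m = tableH x)
    {x : ℕ} (hx : x ≤ n) : cs.maxw0 x = tableH x := by
  refine cs.maxw0_eq_of_isRootCode (C := goldenNonneg)
    (isCartan_symm fun i j hij => (show _ ∨ _ ∨ _ by simpa using hM (i, j) hij).imp_right
      (Or.imp_right fun h5 => ⟨h5, ?_, ?_⟩)) h
    (by norm_num) ?_ ?_ ?_ rfl rfl hL hle hge hx
  · exact ⟨le_rfl, zero_le_one⟩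
  · decide
  · intro z hz hz'
    have h1 : 0 ≤ z.re := hz.1
    have h2 : 0 ≤ z.im := hz.2
    have h3 : 0 ≤ -z.re := hz'.1
    have h4 : 0 ≤ -z.im := hz'.2
    exact QuadraticAlgebra.ext (by simp; omega) (by simp; omega)
  · exact fun d => ⟨Int.natCast_nonneg _, Int.natCast_nonneg _⟩
  · intro d _ d' _ hd
    have h1 := congrArg QuadraticAlgebra.re hd
    have h2 := congrArg QuadraticAlgebra.im hd
    simp only [goldenVal] at h1 h2
    omega

theorem maxw0_H₃ {W : Type*} [Group W] [Finite W] (cs : CoxeterSystem CoxeterMatrix.H₃ W) {x : ℕ}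
    (hx : x ≤ 3) : cs.maxw0 x = tableH x :=
  -- H_3 sits on the nodes 1, 2, 3 of H_4: its roots have digit 0 at position 0, and division by 100
  -- shifts the nodes.
  maxw0_H (L := (rootsH.filter (· % 100 = 0)).map (· / 100)) cs (by decide +kernel)
    ⟨by decide +kernel, by decide +kernel, by decide +kernel, by decide +kernel⟩
    (by decide +kernel) (by decide +kernel) (by decide +kernel) hx

theorem maxw0_H₄ {W : Type*} [Group W] [Finite W] (cs : CoxeterSystem CoxeterMatrix.H₄ W) {x : ℕ}
    (hx : x ≤ 4) : cs.maxw0 x = tableH x :=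
  maxw0_H (L := rootsH) cs (by decide +kernel)
    ⟨by decide +kernel, by decide +kernel, by decide +kernel, by decide +kernel⟩
    (by decide +kernel) (by decide +kernel) (by decide +kernel) hx

end ExceptionalTypes

namespace CoxeterSystem

/-! ### Dihedral groups -/

section Dihedral

variable {B W : Type*} [Group W] {M : CoxeterMatrix B} (cs : CoxeterSystem M W)

/-- For m = 2k the words are the `k`-th power of s_i s_j and its inverse; for m = 2k + 1,
multiplying by s_i on the left equates the power `k + 1` with the power `-k`. -/
theorem simple_mul_simple_pow_eq_one_of_alternatingWord_eq {i j : B} {m : ℕ}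
    (h : cs.wordProd (alternatingWord i j m) = cs.wordProd (alternatingWord j i m)) :
    (cs.simple i * cs.simple j) ^ m = 1 := by
  have hinv : (cs.simple i * cs.simple j)⁻¹ = cs.simple j * cs.simple i := by simp
  rw [prod_alternatingWord_eq_mul_pow, prod_alternatingWord_eq_mul_pow, ← hinv, inv_pow] at h
  rcases Nat.even_or_odd' m with ⟨k, rfl | rfl⟩
  · simp only [even_two, Even.mul_right, if_true, one_mul, ne_eq, OfNat.ofNat_ne_zero,
      not_false_eq_true, mul_div_cancel_left₀] at h
    rw [two_mul, pow_add]
    exact mul_eq_one_iff_eq_inv.2 h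
  · rw [if_neg (by simp), show (2 * k + 1) / 2 = k by omega, if_neg (by simp)] at h
    have h' := congrArg (cs.simple i * ·) h
    rw [simple_mul_simple_cancel_left, ← mul_assoc, ← pow_succ'] at h'
    rw [show 2 * k + 1 = (k + 1) + k by ring, pow_add, h', inv_mul_cancel]

end Dihedral

variable {W : Type*} [Group W] {n : ℕ} (cs : CoxeterSystem (CoxeterMatrix.I (n - 2)) W)

theorem coxeterMatrix_I_of_ne (hn : 2 ≤ n) {i j : Fin 2} (hij : i ≠ j) :
    CoxeterMatrix.I (n - 2) i j = n := by
  simp only [CoxeterMatrix.I, Matrix.of_apply, if_neg hij]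
  omega

include cs in
-- Sending the generators to two adjacent reflections of the dihedral group of order 2n sends their
-- product to a rotation of order `n`.
theorem dvd_of_simple_mul_simple_pow_eq_one (hn : 2 ≤ n) {m : ℕ}
    (h : (cs.simple 0 * cs.simple 1) ^ m = 1) : n ∣ m := by
  have hl : (CoxeterMatrix.I (n - 2)).IsLiftable
      fun i : Fin 2 => (DihedralGroup.sr ((i : ℕ) : ZMod n)) := by
    intro i j
    by_cases hij : i = j
    · subst hij
      simp
    · rw [coxeterMatrix_I_of_ne hn hij, DihedralGroup.sr_mul_sr, DihedralGroup.r_pow]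
      simp
  have := congrArg (cs.lift ⟨_, hl⟩) h
  rw [map_pow, map_mul, lift_apply_simple, lift_apply_simple, map_one,
    DihedralGroup.sr_mul_sr] at this
  rw [← DihedralGroup.orderOf_r_one (n := n)]
  refine orderOf_dvd_of_pow_eq_one ?_
  simpa using this

/-- In rank two the factor left after splitting off the alternating word has no right descent at
all, so it is 1. -/
theorem eq_alternatingWord_of_not_isRightDescent (hn : 2 ≤ n) (w : W) {i j : Fin 2} (hij : i ≠ j)
    (hi : ¬cs.IsRightDescent w i) :
    ∃ k < n, cs.length w = k ∧ w = cs.wordProd (alternatingWord i j k) := by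
  obtain ⟨v, k, rfl, hl, h1, h2, -⟩ := cs.exists_eq_mul_alternatingWord w i j hi
  have hM := coxeterMatrix_I_of_ne hn hij
  have hk := cs.lt_of_not_isRightDescent_mul_alternatingWord (by omega) hl hi
  have hv : v = 1 := by
    by_contra hv
    obtain ⟨l, hl⟩ := cs.exists_rightDescent_of_ne_one hv
    rcases (show l = i ∨ l = j by omega) with rfl | rfl <;> contradiction
  subst hv
  exact ⟨k, by omega, by simpa using hl, one_mul _⟩

/-- Removing either last letter shows `w` to be both alternating words of one length k + 1 ≤ n. Then
(s_0 s_1)^(k+1) = 1, so `n` divides `k + 1`. -/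
theorem length_eq_of_forall_isRightDescent (hn : 2 ≤ n) {w : W}
    (h : ∀ i, cs.IsRightDescent w i) : cs.length w = n := by
  obtain ⟨k, hk, h1, h2⟩ := cs.eq_alternatingWord_of_not_isRightDescent hn (w * cs.simple 0)
    (zero_ne_one) (cs.isRightDescent_iff_not_isRightDescent_mul.1 (h 0))
  obtain ⟨k', hk', h1', h2'⟩ := cs.eq_alternatingWord_of_not_isRightDescent hn (w * cs.simple 1)
    (one_ne_zero) (cs.isRightDescent_iff_not_isRightDescent_mul.1 (h 1))
  have h3 := cs.isRightDescent_iff.1 (h 0)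
  have h4 := cs.isRightDescent_iff.1 (h 1)
  obtain rfl : k = k' := by omega
  have hw : w = cs.wordProd (alternatingWord 1 0 (k + 1)) := by
    rw [alternatingWord_succ, wordProd_concat, ← h2, simple_mul_simple_cancel_right]
  have hw' : w = cs.wordProd (alternatingWord 0 1 (k + 1)) := by
    rw [alternatingWord_succ, wordProd_concat, ← h2', simple_mul_simple_cancel_right]
  have := Nat.le_of_dvd k.succ_pos (cs.dvd_of_simple_mul_simple_pow_eq_one hn
    (cs.simple_mul_simple_pow_eq_one_of_alternatingWord_eq (hw'.symm.trans hw)))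
  omega

theorem maxw0_I [Finite W] (hn : 2 ≤ n) {x : ℕ} (hx : x ≤ 2) :
    cs.maxw0 x = if x = 2 then n else x := by
  obtain ⟨I, w, hI, hw, hl⟩ := (cs.isGreatest_maxw0 (x := x) (by simpa using hx)).1
  rw [← hl]
  interval_cases x
  · rw [Finset.card_eq_zero] at hI
    have := hw.1
    simp only [hI, parabolic, Finset.coe_empty, Set.image_empty, Subgroup.closure_empty,
      Subgroup.mem_bot] at this
    simp [this]
  · obtain ⟨i, rfl⟩ := Finset.card_eq_one.1 hI
    have h1 := hw.1
    simp only [parabolic, Finset.coe_singleton, Set.image_singleton] at h1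
    have h2 := hw.2 (cs.simple i) (Subgroup.subset_closure (by simp))
    rw [length_simple] at h2
    obtain ⟨k, rfl⟩ := Subgroup.mem_closure_singleton.1 h1
    rcases Int.even_or_odd' k with ⟨l, rfl | rfl⟩
    · have : cs.simple i ^ (2 * l) = 1 := by
        rw [zpow_mul, zpow_ofNat, simple_sq, one_zpow]
      rw [this, length_one] at h2
      omega
    · have : cs.simple i ^ (2 * l + 1) = cs.simple i := by
        rw [zpow_add, zpow_mul, zpow_ofNat, simple_sq, one_zpow, one_mul, zpow_one]
      rw [this, length_simple]
      rfl
  · have hu : I = Finset.univ := Finset.eq_univ_of_card _ (by simpa using hI)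
    have htop : cs.parabolic (I : Set (Fin 2)) = ⊤ := by
      rw [parabolic, hu, Finset.coe_univ, Set.image_univ, subgroup_closure_range_simple]
    rw [if_pos rfl]
    refine cs.length_eq_of_forall_isRightDescent hn fun i => ?_
    have := hw.2 (w * cs.simple i) (htop ▸ Subgroup.mem_top _)
    have := cs.length_mul_simple_ne w i
    unfold IsRightDescent
    omega

theorem exists_coxeterSystem_of_isOfType {B B' W : Type*} [Group W] {M : CoxeterMatrix B}
    (cs : CoxeterSystem M W) {X : CoxeterMatrix B'} (h : M.IsOfType X) :
    Nonempty (B ≃ B') ∧ ∃ cs' : CoxeterSystem X W, ∀ x, cs'.maxw0 x = cs.maxw0 x := by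
  obtain ⟨e, rfl⟩ := h
  exact ⟨⟨e⟩, cs.reindex e, cs.maxw0_reindex e⟩

end CoxeterSystem

/-! ### The theorem for all types -/

theorem proposition2p1 {B W : Type*} [Fintype B] [Group W] [Finite W] {M : CoxeterMatrix B}
    (cs : CoxeterSystem M W) (x : ℕ) (hx : x ≤ Fintype.card B) :
    (∀ n : ℕ, M.IsOfType (CoxeterMatrix.A n) → cs.maxw0 x = (x + 1).choose 2) ∧
    (∀ n : ℕ, M.IsOfType (CoxeterMatrix.B n) ∨ M.IsOfType (coxeterC n) → cs.maxw0 x = x ^ 2) ∧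
    (∀ n : ℕ, 3 ≤ n → M.IsOfType (coxeterD n) →
      cs.maxw0 x = if 3 < x then x ^ 2 - x else (x + 1).choose 2) ∧
    (M.IsOfType CoxeterMatrix.E₆ ∨ M.IsOfType CoxeterMatrix.E₇ ∨ M.IsOfType CoxeterMatrix.E₈ →
      cs.maxw0 x = tableE x) ∧
    (M.IsOfType CoxeterMatrix.F₄ → cs.maxw0 x = tableF x) ∧
    (M.IsOfType CoxeterMatrix.H₃ ∨ M.IsOfType CoxeterMatrix.H₄ → cs.maxw0 x = tableH x) ∧
    -- `CoxeterMatrix.I m` has the off-diagonal entry `m + 2`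
    (∀ n : ℕ, 2 ≤ n → M.IsOfType (CoxeterMatrix.I (n - 2)) →
      cs.maxw0 x = if x = 2 then n else x) := by
  have key : ∀ {n : ℕ} {X : CoxeterMatrix (Fin n)}, M.IsOfType X →
      x ≤ n ∧ ∃ cs' : CoxeterSystem X W, cs'.maxw0 x = cs.maxw0 x := fun h => by
    obtain ⟨⟨e⟩, cs', h'⟩ := cs.exists_coxeterSystem_of_isOfType h
    exact ⟨by simpa using hx.trans_eq (Fintype.card_congr e), cs', h' x⟩
  refine ⟨fun n h => ?_, fun n h => ?_, fun n hn h => ?_, ?_, fun h => ?_, ?_, fun n hn h => ?_⟩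
  · obtain ⟨hxn, cs', h'⟩ := key h
    rw [← h', cs'.maxw0_A hxn]
  -- `coxeterC n` unfolds to `CoxeterMatrix.B n`, so both alternatives are the same hypothesis.
  · obtain ⟨hxn, cs', h'⟩ := key (X := CoxeterMatrix.B n) (h.elim id id)
    rw [← h', cs'.maxw0_B hxn]
  · obtain ⟨hxn, cs', h'⟩ := key h
    rw [← h', cs'.maxw0_D hn hxn]
  · rintro (h | h | h) <;> obtain ⟨hxn, cs', h'⟩ := key h <;> rw [← h']
    exacts [maxw0_E₆ cs' hxn, maxw0_E₇ cs' hxn, maxw0_E₈ cs' hxn]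
  · obtain ⟨hxn, cs', h'⟩ := key h
    rw [← h', maxw0_F₄ cs' hxn]
  · rintro (h | h) <;> obtain ⟨hxn, cs', h'⟩ := key h <;> rw [← h']
    exacts [maxw0_H₃ cs' hxn, maxw0_H₄ cs' hxn]
  · obtain ⟨hxn, cs', h'⟩ := key h
    rw [← h', cs'.maxw0_I hn hxn]
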